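/- Let $\Gamma$ be a compact metric graph: finitely many (at least one) edges $e\simeq[0,\ell_e]$ with $\ell_e>0$, glued at finitely many vertices. For a set $V_D$ of vertices, let $-\Delta$ be the self-adjoint operator on $L^2(\Gamma)$ associated with the form $h[f,g]=\int_\Gamma f'\,\overline{g'}\,dx$ on $H^1_0(\Gamma,V_D)$, the space of continuous functions on $\Gamma$ that are $H^1$ on each edge and vanish on $V_D$ (so there are Dirichlet conditions on $V_D$ and standard Kirchhoff conditions at all other vertices). Let $\lambda_1(\Gamma)\le\lambda_2(\Gamma)\le\cdots$ be its eigenvalues, counted with multiplicity. A leaf is a vertex of degree one, and an interior vertex is a vertex that is not a leaf. A compact Dirichlet tree is a connected compact metric graph $\Gamma$ without cycles such that $V_D$ is exactly the set of leaves. A compact Dirichlet tree in the wide sense is the same, except that $V_D$ is only required to contain all leaves, so that Dirichlet conditions at interior vertices are also admitted. Fix integers $k>j\ge1$. Then $$\inf\Big\{\tfrac{\lambda_k(\Gamma)}{\lambda_j(\Gamma)}:\Gamma\text{ a compact Dirichlet tree}\Big\}=1,$$ and the infimum over compact Dirichlet trees in the wide sense is also $1$. In the latter class the infimum is always attained. More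 precisely: 1. If $j\ge2$, then it is attained, already among compact Dirichlet trees, on every equilateral $k$-star (with Dirichlet conditions at its $k$ leaves and a Kirchhoff condition at its centre). 2. If $j=1$, then every compact Dirichlet tree in the wide sense with $\lambda_k(\Gamma)/\lambda_1(\Gamma)=1$ has a Dirichlet condition at an interior vertex, and is thus effectively disconnected: the removal of the Dirichlet vertices disconnects $\Gamma$. 3. For every $j\ge1$ it is attained on every equilateral $k$-star with Dirichlet conditions at its leaves and at its centre. -/

import Mathlib

open MeasureTheory
open scoped ContDiff

/-- A compact metric graph together with its set of Dirichlet vertices. Every edge `e` is identified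
with the interval `[0, len e]`, the point `0` being glued to the vertex `src e` and the point
`len e` to the vertex `tgt e`. Loops and parallel edges are allowed. At the vertices outside
`dir` the standard (continuity and Kirchhoff) conditions are imposed. -/
structure QuantumGraph where
  /-- the vertices -/
  V : Type
  /-- the edges -/
  E : Type
  [fintypeV : Fintype V]
  [fintypeE : Fintype E]
  [nonemptyE : Nonempty E]
  /-- the vertex at the initial point of an edge -/
  src : E → V
  /-- the vertex at the terminal point of an edge -/
  tgt : E → V
  /-- the edge lengths -/
  len : E → ℝ
  len_pos : ∀ e, 0 < len e
  /-- the Dirichlet vertices -/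
  dir : Set V

attribute [instance] QuantumGraph.fintypeV QuantumGraph.fintypeE QuantumGraph.nonemptyE

noncomputable section

namespace QuantumGraph

variable (Γ : QuantumGraph)

/-! ### Combinatorics -/

/-- The degree of a vertex: the number of incident edges, a loop counting twice. -/
def degree (v : Γ.V) : ℕ :=
  Nat.card {e : Γ.E // Γ.src e = v} + Nat.card {e : Γ.E // Γ.tgt e = v}

/-- A leaf is a vertex of degree one. -/
def IsLeaf (v : Γ.V) : Prop := Γ.degree v = 1

/-- The edge `e` is incident with the vertex `v`. -/
def Incident (e : Γ.E) (v : Γ.V) : Prop := Γ.src e = v ∨ Γ.tgt e = v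

/-- Connectedness of the graph. -/
def IsConnected : Prop :=
  (SimpleGraph.fromRel fun v w : Γ.V => ∃ e, Γ.src e = v ∧ Γ.tgt e = w).Connected

/-- The first Betti number `|E| - |V| + 1` (of a connected graph). -/
def betti : ℤ := (Fintype.card Γ.E : ℤ) - (Fintype.card Γ.V : ℤ) + 1

/-- A tree is a connected graph without independent cycles. -/
def IsTree : Prop := Γ.IsConnected ∧ Γ.betti = 0

/-- A (compact) Dirichlet tree in the strict sense: Dirichlet conditions at all leaves, Kirchhoff
conditions at all interior vertices. -/
def IsDirichletTree : Prop := Γ.IsTree ∧ ∀ v, v ∈ Γ.dir ↔ Γ.IsLeaf v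

/-- A (compact) Dirichlet tree in the wide sense: Dirichlet conditions at all leaves, and either
a Dirichlet or a Kirchhoff condition at each interior vertex. -/
def IsWideDirichletTree : Prop := Γ.IsTree ∧ ∀ v, Γ.IsLeaf v → v ∈ Γ.dir

/-- There is a Dirichlet condition at an interior (non-leaf) vertex. -/
def HasInteriorDirichletVertex : Prop := ∃ v ∈ Γ.dir, 2 ≤ Γ.degree v

/-- The graph falls apart when its Dirichlet vertices are removed: it is not possible to pass
between any two edges through non-Dirichlet vertices only. -/
def IsEffectivelyDisconnected : Prop :=
  ¬ (SimpleGraph.fromRel fun e e' : Γ.E =>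
      ∃ v, v ∉ Γ.dir ∧ Γ.Incident e v ∧ Γ.Incident e' v).Preconnected

/-! ### Function spaces and the Laplacian -/

/-- The Hilbert space `L²(Γ) = ⨁ₑ L²(0, len e)` of complex-valued functions. -/
abbrev L2 : Type := PiLp 2 fun e : Γ.E => Lp ℂ 2 (volume.restrict (Set.Icc 0 (Γ.len e)))

/-- `u'` is the weak derivative of `u` on the open interval `(0, ℓ)`. -/
def HasWeakDeriv (ℓ : ℝ) (u u' : ℝ → ℂ) : Prop :=
  ∀ φ : ℝ → ℝ, ContDiff ℝ ∞ φ → HasCompactSupport φ → tsupport φ ⊆ Set.Ioo 0 ℓ →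
    ∫ x in Set.Icc 0 ℓ, deriv φ x • u x = - ∫ x in Set.Icc 0 ℓ, φ x • u' x

/-- `f ∈ C(Γ)`, with value `c v` at each vertex `v`: the class `f ∈ L²(Γ)` has a representative that
is continuous on each closed edge and takes the values `c` at the end points. -/
def IsContinuousWithValues (f : Γ.L2) (c : Γ.V → ℂ) : Prop :=
  ∀ e, ∃ F : ℝ → ℂ, ContinuousOn F (Set.Icc 0 (Γ.len e)) ∧
    (f e : ℝ → ℂ) =ᵐ[volume.restrict (Set.Icc 0 (Γ.len e))] F ∧
    F 0 = c (Γ.src e) ∧ F (Γ.len e) = c (Γ.tgt e)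

/-- `f ∈ H¹₀(Γ, dir)`, with weak derivative `f' ∈ L²(Γ)`. -/
def IsH10 (f f' : Γ.L2) : Prop :=
  (∀ e, HasWeakDeriv (Γ.len e) (f e) (f' e)) ∧
    ∃ c : Γ.V → ℂ, Γ.IsContinuousWithValues f c ∧ ∀ v ∈ Γ.dir, c v = 0

/-- `f` is in the domain of the Laplacian `-Δ` and `-Δ f = u`, where `-Δ` is the operator on `L²(Γ)`
associated with the form `h[f, g] = ∫ f' \bar g'` with form domain `H¹₀(Γ, dir)`. (Mathlib's inner
product is conjugate-linear in the first variable.) -/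
def IsLaplacian (f u : Γ.L2) : Prop :=
  ∃ f' : Γ.L2, Γ.IsH10 f f' ∧
    ∀ g g' : Γ.L2, Γ.IsH10 g g' → inner ℂ g' f' = inner ℂ g u

/-- `f` lies in the eigenspace of `-Δ` for the (real) number `μ`. -/
def IsEigenvector (μ : ℝ) (f : Γ.L2) : Prop := Γ.IsLaplacian f ((μ : ℂ) • f)

/-- `λ_k(Γ)`, for `k ≥ 1`: the `k`-th smallest eigenvalue of the Laplacian, counted with
multiplicity, that is, the smallest `t` such that there are `k` linearly independent
eigenfunctions with eigenvalues at most `t`. -/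
def eigenvalue (k : ℕ) : ℝ :=
  sInf {t : ℝ | ∃ f : Fin k → Γ.L2, LinearIndependent ℂ f ∧
    ∀ i, ∃ μ : ℝ, μ ≤ t ∧ Γ.IsEigenvector μ (f i)}

/-- The eigenvalue ratio `λ_k(Γ) / λ_j(Γ)`. -/
def ratio (k j : ℕ) : ℝ := Γ.eigenvalue k / Γ.eigenvalue j

end QuantumGraph

/-- The equilateral star with `k` edges of length `ℓ`: the centre `none` is joined to the vertices
`some i`; the set of Dirichlet vertices is `D`. -/
abbrev equilateralStar (k : ℕ) [NeZero k] (ℓ : ℝ) (hℓ : 0 < ℓ) (D : Set (Option (Fin k))) :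
    QuantumGraph where
  V := Option (Fin k)
  E := Fin k
  src := fun _ => none
  tgt := some
  len := fun _ => ℓ
  len_pos := fun _ => hℓ
  dir := D

/-- The equilateral `k`-star with Dirichlet conditions at the outer vertices and a Kirchhoff
condition at the centre. -/
abbrev dirichletStar (k : ℕ) [NeZero k] (ℓ : ℝ) (hℓ : 0 < ℓ) : QuantumGraph :=
  equilateralStar k ℓ hℓ {none}ᶜ

/-- The equilateral `k`-star with Dirichlet conditions at all vertices, including the centre. -/
abbrev dirichletStarWithDirichletCentre (k : ℕ) [NeZero k] (ℓ : ℝ) (hℓ : 0 < ℓ) : QuantumGraph :=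
  equilateralStar k ℓ hℓ Set.univ

end

/-!
The form domain, with its energy inner product, embeds compactly into `L²(Γ)` by an operator `J`,
and the eigenvalue equation reads `g = μ J†J g` with the adjoint taken for the energy. Once the
Dirichlet vertices rule out the constants, the spectrum is thus positive and discrete, and its
bottom `λ₁` is the minimum of the Rayleigh quotient; in particular all ratios are at least `1`.

If `λ_k = λ₁` for some `k ≥ 2`, the eigenspace of `λ₁` contains a nonzero function vanishing at a
prescribed end of an edge, along with its derivative if that vertex is a Dirichlet vertex. Its
modulus minimizes the Rayleigh quotient as well, so it is again a (trigonometric) eigenfunction.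
Being nonnegative, it vanishes on every edge that contains a zero of it other than a Dirichlet
vertex, and by the Kirchhoff conditions on all edges at a non-Dirichlet vertex where it is zero.
Were `Γ` not disconnected by its Dirichlet vertices, the function would thus vanish identically.

On a star with Dirichlet leaves, an eigenvalue `κ²` for which all `κ ℓₑ < π` satisfies the secular
equation `∑ cot (κ ℓₑ) = 0`, whose left-hand side is decreasing in `κ`. On equilateral stars this
makes `λ₂ = ⋯ = λ_k = (π / ℓ)²`. On a star with `k + 1` edges of length `1` and `N` edges of length
`1 / 2`, it forces `λ₁ → π²` as `N → ∞` while `λ_k ≤ π²`, so that the ratios tend to `1`.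
-/

/-! ### Primitives and weak derivatives on an interval -/

section Primitive

variable {𝕜 E : Type*} [RCLike 𝕜] [NormedAddCommGroup E] [NormedSpace ℝ E] {ℓ : ℝ} {g : ℝ → E}

/-- The primitive of `g` with value `c` at `0`. On `[0, ℓ]` it is the absolutely continuous
representative of an `H¹` function with derivative `g`. -/
noncomputable def primitiveFrom (c : E) (g : ℝ → E) (x : ℝ) : E := c + ∫ t in (0 : ℝ)..x, g t

lemma primitiveFrom_zero_right (c : E) (g : ℝ → E) : primitiveFrom c g 0 = c := by
  simp [primitiveFrom]

lemma setIntegral_Icc_eq_intervalIntegral {a b : ℝ} (hab : a ≤ b) (f : ℝ → E) :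
    ∫ x in Set.Icc a b, f x = ∫ x in a..b, f x := by
  rw [intervalIntegral.integral_of_le hab, integral_Icc_eq_integral_Ioc]

lemma ae_restrict_Icc_mem_Ioo (a b : ℝ) :
    ∀ᵐ x ∂(volume.restrict (Set.Icc a b)), x ∈ Set.Ioo a b := by
  rw [← Measure.restrict_congr_set (Ioo_ae_eq_Icc (μ := volume) (a := a) (b := b))]
  exact ae_restrict_mem measurableSet_Ioo

lemma continuousOn_intervalIntegral_Icc (hℓ : 0 ≤ ℓ) (hg : IntegrableOn g (Set.Icc 0 ℓ)) :
    ContinuousOn (fun x => ∫ t in (0 : ℝ)..x, g t) (Set.Icc 0 ℓ) := by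
  rw [← Set.uIcc_of_le hℓ] at hg ⊢
  exact intervalIntegral.continuousOn_primitive_interval hg

lemma continuousOn_primitiveFrom (hℓ : 0 ≤ ℓ) (c : E) (hg : IntegrableOn g (Set.Icc 0 ℓ)) :
    ContinuousOn (primitiveFrom c g) (Set.Icc 0 ℓ) :=
  continuousOn_const.add (continuousOn_intervalIntegral_Icc hℓ hg)

lemma integrableOn_primitiveFrom (hℓ : 0 ≤ ℓ) (c : E) (hg : IntegrableOn g (Set.Icc 0 ℓ)) :
    IntegrableOn (primitiveFrom c g) (Set.Icc 0 ℓ) :=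
  (continuousOn_primitiveFrom hℓ c hg).integrableOn_Icc

lemma intervalIntegral_congr_ae_restrict_Icc {g₁ g₂ : ℝ → E}
    (h : g₁ =ᵐ[volume.restrict (Set.Icc 0 ℓ)] g₂) {x : ℝ} (hx : x ∈ Set.Icc 0 ℓ) :
    ∫ t in (0 : ℝ)..x, g₁ t = ∫ t in (0 : ℝ)..x, g₂ t := by
  rw [← setIntegral_Icc_eq_intervalIntegral hx.1, ← setIntegral_Icc_eq_intervalIntegral hx.1]
  exact integral_congr_ae
    (ae_restrict_of_ae_restrict_of_subset (Set.Icc_subset_Icc_right hx.2) h)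

variable [NormedSpace 𝕜 E] [CompleteSpace E] {φ φ' : ℝ → 𝕜}

lemma setIntegral_smul_intervalIntegral_swap (hφ' : IntegrableOn φ' (Set.Icc 0 ℓ))
    (hg : IntegrableOn g (Set.Icc 0 ℓ)) :
    ∫ x in Set.Icc 0 ℓ, φ' x • ∫ t in (0 : ℝ)..x, g t =
      ∫ t in Set.Icc 0 ℓ, (∫ x in t..ℓ, φ' x) • g t := by
  let K : ℝ → ℝ → E := fun x t => {p : ℝ × ℝ | p.2 ≤ p.1}.indicator (fun p => φ' p.1 • g p.2) (x, t)
  have hK : Integrable (Function.uncurry K)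
      ((volume.restrict (Set.Icc 0 ℓ)).prod (volume.restrict (Set.Icc 0 ℓ))) :=
    (hφ'.smul_prod hg).indicator (measurableSet_le measurable_snd measurable_fst)
  have hinner_left : ∀ x ∈ Set.Icc 0 ℓ,
      ∫ t in Set.Icc 0 ℓ, K x t = φ' x • ∫ t in (0 : ℝ)..x, g t := by
    intro x hx
    have hslice : Set.Icc 0 ℓ ∩ Set.Iic x = Set.Icc 0 x := by
      rw [← Set.Ici_inter_Iic, Set.inter_assoc, Set.Iic_inter_Iic, min_eq_right hx.2,
        Set.Ici_inter_Iic]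
    calc ∫ t in Set.Icc 0 ℓ, K x t
        = ∫ t in Set.Icc 0 ℓ, (Set.Iic x).indicator (fun t => φ' x • g t) t := rfl
      _ = φ' x • ∫ t in (0 : ℝ)..x, g t := by
        rw [setIntegral_indicator measurableSet_Iic, hslice, integral_smul,
          setIntegral_Icc_eq_intervalIntegral hx.1]
  have hinner_right : ∀ t ∈ Set.Icc 0 ℓ,
      ∫ x in Set.Icc 0 ℓ, K x t = (∫ x in t..ℓ, φ' x) • g t := by
    intro t ht
    have hslice : Set.Icc 0 ℓ ∩ Set.Ici t = Set.Icc t ℓ := by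
      rw [← Set.Ici_inter_Iic, Set.inter_right_comm, Set.Ici_inter_Ici, sup_eq_right.2 ht.1,
        Set.Ici_inter_Iic]
    calc ∫ x in Set.Icc 0 ℓ, K x t
        = ∫ x in Set.Icc 0 ℓ, (Set.Ici t).indicator (fun x => φ' x • g t) x := rfl
      _ = (∫ x in t..ℓ, φ' x) • g t := by
        rw [setIntegral_indicator measurableSet_Ici, hslice, integral_smul_const,
          setIntegral_Icc_eq_intervalIntegral ht.2]
  rw [← setIntegral_congr_fun measurableSet_Icc hinner_left,
    ← setIntegral_congr_fun measurableSet_Icc hinner_right]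
  exact integral_integral_swap hK

lemma setIntegral_deriv_smul_primitiveFrom (hℓ : 0 ≤ ℓ) (c : E) (hg : IntegrableOn g (Set.Icc 0 ℓ))
    (hφ : ∀ x, HasDerivAt φ (φ' x) x) (hφ' : Continuous φ') :
    ∫ x in Set.Icc 0 ℓ, φ' x • primitiveFrom c g x =
      φ ℓ • primitiveFrom c g ℓ - φ 0 • c - ∫ x in Set.Icc 0 ℓ, φ x • g x := by
  have hφc : Continuous φ := continuous_iff_continuousAt.2 fun x => (hφ x).continuousAt
  have hftc : ∀ t, ∫ x in t..ℓ, φ' x = φ ℓ - φ t := fun t =>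
    intervalIntegral.integral_eq_sub_of_hasDerivAt (fun x _ => hφ x) (hφ'.intervalIntegrable _ _)
  have hswap : ∫ x in Set.Icc 0 ℓ, φ' x • ∫ t in (0 : ℝ)..x, g t =
      φ ℓ • (∫ t in (0 : ℝ)..ℓ, g t) - ∫ t in Set.Icc 0 ℓ, φ t • g t := by
    simp_rw [setIntegral_smul_intervalIntegral_swap hφ'.integrableOn_Icc hg, hftc, sub_smul]
    rw [integral_sub (f := fun t => φ ℓ • g t) (hg.smul (φ ℓ))
        (hg.continuousOn_smul hφc.continuousOn isCompact_Icc), integral_smul,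
      setIntegral_Icc_eq_intervalIntegral hℓ]
  have hprim : IntegrableOn (fun x => φ' x • ∫ t in (0 : ℝ)..x, g t) (Set.Icc 0 ℓ) :=
    (hφ'.continuousOn.smul (continuousOn_intervalIntegral_Icc hℓ hg)).integrableOn_Icc
  simp_rw [primitiveFrom, smul_add]
  rw [integral_add (hφ'.integrableOn_Icc.smul_const c) hprim, integral_smul_const,
    setIntegral_Icc_eq_intervalIntegral hℓ, hftc, hswap, sub_smul]
  abel

end Primitive

/-- Smooth functions with compact support in `(0, ℓ)`, against which weak derivatives are tested. -/
structure IsTestFunction (ℓ : ℝ) (φ : ℝ → ℝ) : Prop where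
  contDiff : ContDiff ℝ ∞ φ
  hasCompactSupport : HasCompactSupport φ
  tsupport_subset : tsupport φ ⊆ Set.Ioo 0 ℓ

namespace IsTestFunction

variable {ℓ : ℝ} {φ ψ : ℝ → ℝ}

lemma sub (hφ : IsTestFunction ℓ φ) (hψ : IsTestFunction ℓ ψ) : IsTestFunction ℓ (φ - ψ) where
  contDiff := hφ.contDiff.sub hψ.contDiff
  hasCompactSupport := hφ.hasCompactSupport.sub hψ.hasCompactSupport
  tsupport_subset := (tsupport_sub φ ψ).trans
    (Set.union_subset hφ.tsupport_subset hψ.tsupport_subset)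

lemma const_smul (hφ : IsTestFunction ℓ φ) (a : ℝ) : IsTestFunction ℓ (a • φ) where
  contDiff := hφ.contDiff.const_smul a
  hasCompactSupport := hφ.hasCompactSupport.smul_left (f := fun _ => a)
  tsupport_subset := (tsupport_smul_subset_right (fun _ => a) φ).trans hφ.tsupport_subset

lemma eq_zero (hφ : IsTestFunction ℓ φ) {x : ℝ} (hx : x ∉ Set.Ioo 0 ℓ) : φ x = 0 :=
  image_eq_zero_of_notMem_tsupport fun h => hx (hφ.tsupport_subset h)

lemma of_eq_zero_off_Icc (hφ : ContDiff ℝ ∞ φ) {a b : ℝ} (ha : 0 < a) (hb : b < ℓ)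
    (h0 : ∀ x ∉ Set.Icc a b, φ x = 0) : IsTestFunction ℓ φ := by
  have hsub : tsupport φ ⊆ Set.Icc a b :=
    closure_minimal (fun x hx => by_contra fun h => hx (h0 x h)) isClosed_Icc
  exact ⟨hφ, HasCompactSupport.intro isCompact_Icc fun {x} hx => h0 x hx,
    hsub.trans (Set.Icc_subset_Ioo ha hb)⟩

lemma exists_eq_zero_off_Icc (hφ : IsTestFunction ℓ φ) :
    ∃ a b, 0 < a ∧ b < ℓ ∧ ∀ x ∉ Set.Icc a b, φ x = 0 := by
  rcases (tsupport φ).eq_empty_or_nonempty with hempty | hne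
  · exact ⟨1, ℓ - 1, one_pos, by linarith, fun x _ => by simp [tsupport_eq_empty_iff.1 hempty]⟩
  · obtain ⟨a, ha_mem, ha⟩ := hφ.hasCompactSupport.isCompact.exists_isLeast hne
    obtain ⟨b, hb_mem, hb⟩ := hφ.hasCompactSupport.isCompact.exists_isGreatest hne
    exact ⟨a, b, (hφ.tsupport_subset ha_mem).1, (hφ.tsupport_subset hb_mem).2, fun x hx =>
      image_eq_zero_of_notMem_tsupport fun h => hx ⟨ha h, hb h⟩⟩

lemma exists_deriv_eq (hψ : IsTestFunction ℓ ψ) (hint : ∫ x in (0 : ℝ)..ℓ, ψ x = 0) :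
    ∃ φ, IsTestFunction ℓ φ ∧ deriv φ = ψ := by
  obtain ⟨a, b, ha, hb, hψ0⟩ := hψ.exists_eq_zero_off_Icc
  have hψc : Continuous ψ := hψ.contDiff.continuous
  have hderiv : deriv (fun x => ∫ t in (0 : ℝ)..x, ψ t) = ψ :=
    funext fun x => hψc.deriv_integral _ 0 x
  have hsmooth : ContDiff ℝ ∞ fun x => ∫ t in (0 : ℝ)..x, ψ t := by
    rw [contDiff_infty_iff_deriv, hderiv]
    exact ⟨intervalIntegral.differentiable_integral_of_continuous hψc, hψ.contDiff⟩
  have hvanish : ∀ y x : ℝ, (∀ t ∈ Set.uIcc y x, t ∉ Set.Icc a b) → ∫ t in y..x, ψ t = 0 :=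
    fun y x h => by
      rw [intervalIntegral.integral_congr (g := 0) fun t ht => hψ0 t (h t ht)]
      simp
  refine ⟨_, of_eq_zero_off_Icc hsmooth ha hb fun x hx => ?_, hderiv⟩
  rcases lt_or_ge x a with hxa | hxa
  · refine hvanish 0 x fun t ht hmem => ?_
    exact absurd (ht.2.trans_lt (max_lt ha hxa)) (not_lt.2 hmem.1)
  · have hbx : b < x := lt_of_not_ge fun hxb => hx ⟨hxa, hxb⟩
    have hright : ∫ t in ℓ..x, ψ t = 0 := hvanish ℓ x fun t ht hmem =>
      absurd ((lt_min hb hbx).trans_le ht.1) (not_lt.2 hmem.2)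
    rw [← intervalIntegral.integral_add_adjacent_intervals (hψc.intervalIntegrable 0 ℓ)
      (hψc.intervalIntegrable ℓ x), hint, hright, add_zero]

lemma exists_integral_eq_one (hℓ : 0 < ℓ) :
    ∃ φ, IsTestFunction ℓ φ ∧ ∫ x in Set.Icc 0 ℓ, φ x = 1 := by
  let B : ContDiffBump (ℓ / 2) := ⟨ℓ / 8, ℓ / 4, by positivity, by linarith⟩
  have hB : IsTestFunction ℓ (B.normed volume) := by
    refine ⟨B.contDiff_normed, B.hasCompactSupport_normed, ?_⟩
    rw [B.tsupport_normed_eq, Real.closedBall_eq_Icc]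
    exact Set.Icc_subset_Ioo (by simp only [B]; linarith) (by simp only [B]; linarith)
  refine ⟨_, hB, ?_⟩
  rw [setIntegral_eq_integral_of_forall_compl_eq_zero, B.integral_normed]
  exact fun x hx => hB.eq_zero fun h => hx (Set.Ioo_subset_Icc_self h)

lemma integrableOn (hφ : IsTestFunction ℓ φ) : IntegrableOn φ (Set.Icc 0 ℓ) :=
  hφ.contDiff.continuous.integrableOn_Icc

lemma integrableOn_smul (hφ : IsTestFunction ℓ φ) {u : ℝ → ℂ} (hu : IntegrableOn u (Set.Icc 0 ℓ)) :
    IntegrableOn (fun x => φ x • u x) (Set.Icc 0 ℓ) :=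
  hu.continuousOn_smul hφ.contDiff.continuous.continuousOn isCompact_Icc

end IsTestFunction

lemma ae_eq_zero_of_forall_isTestFunction {ℓ : ℝ} {u : ℝ → ℂ} (hu : IntegrableOn u (Set.Icc 0 ℓ))
    (h : ∀ φ, IsTestFunction ℓ φ → ∫ x in Set.Icc 0 ℓ, φ x • u x = 0) :
    u =ᵐ[volume.restrict (Set.Icc 0 ℓ)] 0 := by
  have hIoo := isOpen_Ioo.ae_eq_zero_of_integral_contDiff_smul_eq_zero (U := Set.Ioo (0 : ℝ) ℓ)
    (hu.locallyIntegrable.locallyIntegrableOn _) fun φ hsmooth hcompact hsub =>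
      h φ ⟨hsmooth, hcompact, hsub⟩
  filter_upwards [hIoo, ae_restrict_Icc_mem_Ioo 0 ℓ] with x hx hmem using hx hmem

/-- The complex Hilbert space `L²(0, ℓ)`. -/
abbrev L2Interval (ℓ : ℝ) : Type := Lp ℂ 2 (volume.restrict (Set.Icc 0 ℓ))

lemma integrableOn_L2Interval {ℓ : ℝ} (g : L2Interval ℓ) : IntegrableOn g (Set.Icc 0 ℓ) :=
  (Lp.memLp g).integrable one_le_two

namespace QuantumGraph

section HasWeakDeriv

variable {ℓ : ℝ} {u u' : ℝ → ℂ}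

lemma hasWeakDeriv_of_ae_eq_primitiveFrom {c : ℂ} (hℓ : 0 ≤ ℓ) (hu' : IntegrableOn u' (Set.Icc 0 ℓ))
    (hu : u =ᵐ[volume.restrict (Set.Icc 0 ℓ)] primitiveFrom c u') : HasWeakDeriv ℓ u u' := by
  intro φ hsmooth hcompact hsub
  have hφ : IsTestFunction ℓ φ := ⟨hsmooth, hcompact, hsub⟩
  calc ∫ x in Set.Icc 0 ℓ, deriv φ x • u x
      = ∫ x in Set.Icc 0 ℓ, deriv φ x • primitiveFrom c u' x :=
        integral_congr_ae (hu.mono fun x hx => congrArg (deriv φ x • ·) hx)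
    _ = φ ℓ • primitiveFrom c u' ℓ - φ 0 • c - ∫ x in Set.Icc 0 ℓ, φ x • u' x :=
        setIntegral_deriv_smul_primitiveFrom hℓ c hu'
          (fun x => (hsmooth.differentiable (by simp) x).hasDerivAt)
          (hsmooth.continuous_deriv (by simp))
    _ = -∫ x in Set.Icc 0 ℓ, φ x • u' x := by
        rw [hφ.eq_zero (by simp), hφ.eq_zero (by simp), zero_smul, zero_smul, sub_zero, zero_sub]

lemma HasWeakDeriv.sub {v v' : ℝ → ℂ} (h : HasWeakDeriv ℓ u u') (h' : HasWeakDeriv ℓ v v')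
    (hu : IntegrableOn u (Set.Icc 0 ℓ)) (hv : IntegrableOn v (Set.Icc 0 ℓ))
    (hu' : IntegrableOn u' (Set.Icc 0 ℓ)) (hv' : IntegrableOn v' (Set.Icc 0 ℓ)) :
    HasWeakDeriv ℓ (u - v) (u' - v') := by
  intro φ hsmooth hcompact hsub
  have hφ : IsTestFunction ℓ φ := ⟨hsmooth, hcompact, hsub⟩
  have hderiv : ContinuousOn (deriv φ) (Set.Icc 0 ℓ) :=
    (hsmooth.continuous_deriv (by simp)).continuousOn
  simp only [Pi.sub_apply, smul_sub]
  rw [integral_sub (hu.continuousOn_smul hderiv isCompact_Icc)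
      (hv.continuousOn_smul hderiv isCompact_Icc),
    integral_sub (hφ.integrableOn_smul hu') (hφ.integrableOn_smul hv'),
    h φ hsmooth hcompact hsub, h' φ hsmooth hcompact hsub, neg_sub_neg, neg_sub]

/-- The du Bois-Reymond lemma: a test function minus a multiple of a fixed bump has integral zero,
hence is the derivative of a test function. -/
lemma HasWeakDeriv.exists_ae_eq_const (hℓ : 0 < ℓ) (hu : IntegrableOn u (Set.Icc 0 ℓ))
    (h : HasWeakDeriv ℓ u 0) : ∃ c : ℂ, u =ᵐ[volume.restrict (Set.Icc 0 ℓ)] fun _ => c := by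
  obtain ⟨η, hη, hη_int⟩ := IsTestFunction.exists_integral_eq_one hℓ
  set c : ℂ := ∫ x in Set.Icc 0 ℓ, η x • u x with hc
  have hmean : ∀ ψ, IsTestFunction ℓ ψ →
      ∫ x in Set.Icc 0 ℓ, ψ x • u x = (∫ x in Set.Icc 0 ℓ, ψ x) • c := by
    intro ψ hψ
    set I : ℝ := ∫ x in Set.Icc 0 ℓ, ψ x
    have hint : ∫ x in (0 : ℝ)..ℓ, (ψ - I • η) x = 0 := by
      simp only [Pi.sub_apply, Pi.smul_apply]
      rw [← setIntegral_Icc_eq_intervalIntegral hℓ.le, integral_sub (g := fun x => I • η x)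
        hψ.integrableOn (hη.integrableOn.smul I), integral_smul, hη_int, smul_eq_mul, mul_one,
        sub_self]
    obtain ⟨φ, hφ, hφ_deriv⟩ := (hψ.sub (hη.const_smul I)).exists_deriv_eq hint
    have hweak := h φ hφ.contDiff hφ.hasCompactSupport hφ.tsupport_subset
    simp only [hφ_deriv, Pi.sub_apply, Pi.smul_apply, sub_smul, smul_assoc, Pi.zero_apply,
      smul_zero, integral_zero, neg_zero] at hweak
    rwa [integral_sub (g := fun x => I • η x • u x) (hψ.integrableOn_smul hu)
      ((hη.integrableOn_smul hu).smul I), integral_smul, ← hc, sub_eq_zero] at hweak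
  refine ⟨c, ?_⟩
  have hzero := ae_eq_zero_of_forall_isTestFunction (hu.sub (integrable_const c)) fun ψ hψ => by
    simp only [Pi.sub_apply, smul_sub]
    rw [integral_sub (hψ.integrableOn_smul hu) (hψ.integrableOn.smul_const c), integral_smul_const,
      hmean ψ hψ, sub_self]
  exact hzero.mono fun x hx => sub_eq_zero.1 hx

lemma HasWeakDeriv.exists_ae_eq_primitiveFrom (hℓ : 0 < ℓ) (hu : IntegrableOn u (Set.Icc 0 ℓ))
    (hu' : IntegrableOn u' (Set.Icc 0 ℓ)) (h : HasWeakDeriv ℓ u u') :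
    ∃ c : ℂ, u =ᵐ[volume.restrict (Set.Icc 0 ℓ)] primitiveFrom c u' := by
  have hP := integrableOn_primitiveFrom hℓ.le 0 hu'
  have hdiff : HasWeakDeriv ℓ (u - primitiveFrom 0 u') 0 := by
    have hPweak := hasWeakDeriv_of_ae_eq_primitiveFrom (c := 0) hℓ.le hu' Filter.EventuallyEq.rfl
    simpa only [sub_self] using h.sub hPweak hu hP hu' hu'
  obtain ⟨c, hc⟩ := hdiff.exists_ae_eq_const hℓ (hu.sub hP)
  refine ⟨c, hc.mono fun x hx => ?_⟩
  rw [Pi.sub_apply, sub_eq_iff_eq_add] at hx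
  simpa [primitiveFrom] using hx

lemma HasWeakDeriv.ae_eq_zero (hu' : IntegrableOn u' (Set.Icc 0 ℓ)) (h : HasWeakDeriv ℓ u u')
    (hu : u =ᵐ[volume.restrict (Set.Icc 0 ℓ)] 0) : u' =ᵐ[volume.restrict (Set.Icc 0 ℓ)] 0 := by
  refine ae_eq_zero_of_forall_isTestFunction hu' fun φ hφ => ?_
  have hleft : ∫ x in Set.Icc 0 ℓ, deriv φ x • u x = 0 :=
    integral_eq_zero_of_ae (hu.mono fun x hx => by simp [hx])
  rw [← neg_eq_zero, ← h φ hφ.contDiff hφ.hasCompactSupport hφ.tsupport_subset, hleft]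

end HasWeakDeriv

variable {Γ : QuantumGraph}

/-- The absolutely continuous representative of `f` with derivative `f'` is continuous on `Γ`, with
value `c v` at the vertex `v`. -/
def IsPrimitiveWithValues (Γ : QuantumGraph) (f f' : Γ.L2) (c : Γ.V → ℂ) : Prop :=
  ∀ e, f e =ᵐ[volume.restrict (Set.Icc 0 (Γ.len e))] primitiveFrom (c (Γ.src e)) (f' e) ∧
    primitiveFrom (c (Γ.src e)) (f' e) (Γ.len e) = c (Γ.tgt e)

lemma isH10_iff_exists_isPrimitiveWithValues {f f' : Γ.L2} :
    Γ.IsH10 f f' ↔ ∃ c : Γ.V → ℂ, (∀ v ∈ Γ.dir, c v = 0) ∧ Γ.IsPrimitiveWithValues f f' c := by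
  have hcont : ∀ e c, ContinuousOn (primitiveFrom c (f' e)) (Set.Icc 0 (Γ.len e)) := fun e c =>
    continuousOn_primitiveFrom (Γ.len_pos e).le c (integrableOn_L2Interval (f' e))
  constructor
  · rintro ⟨hweak, c, hc, hdir⟩
    refine ⟨c, hdir, fun e => ?_⟩
    obtain ⟨a, ha⟩ := (hweak e).exists_ae_eq_primitiveFrom (Γ.len_pos e)
      (integrableOn_L2Interval (f e)) (integrableOn_L2Interval (f' e))
    obtain ⟨F, hF, hfF, hF_src, hF_tgt⟩ := hc e
    have heq : Set.EqOn F (primitiveFrom a (f' e)) (Set.Icc 0 (Γ.len e)) :=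
      Measure.eqOn_Icc_of_ae_eq volume (Γ.len_pos e).ne (hfF.symm.trans ha) hF (hcont e a)
    obtain rfl : a = c (Γ.src e) := by
      rw [← hF_src, heq (Set.left_mem_Icc.2 (Γ.len_pos e).le), primitiveFrom_zero_right]
    exact ⟨ha, by rw [← hF_tgt, heq (Set.right_mem_Icc.2 (Γ.len_pos e).le)]⟩
  · rintro ⟨c, hdir, h⟩
    exact ⟨fun e => hasWeakDeriv_of_ae_eq_primitiveFrom (Γ.len_pos e).le
      (integrableOn_L2Interval (f' e)) (h e).1, c,
      fun e => ⟨_, hcont e _, (h e).1, primitiveFrom_zero_right _ _, (h e).2⟩, hdir⟩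

end QuantumGraph

/-! ### The eigenvalue problem `g = μ J†J g` of a compact operator -/

section Gram

open Filter Topology

variable {𝕜 G L : Type*} [RCLike 𝕜] [NormedAddCommGroup G] [InnerProductSpace 𝕜 G]
  [NormedAddCommGroup L] [InnerProductSpace 𝕜 L] {J : G →L[𝕜] L} {m μ ν : ℝ} {g h : G}

/-- `g` solves the eigenvalue equation `g = μ J†J g` in weak form. When `J` embeds the form domain
of a positive form into the ambient Hilbert space, this is the eigenvalue equation of the associated
operator. The zero vector is allowed. -/
def IsGramEigenvector (J : G →L[𝕜] L) (μ : ℝ) (g : G) : Prop :=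
  ∀ h : G, inner 𝕜 h g = inner 𝕜 (J h) ((μ : 𝕜) • J g)

lemma IsGramEigenvector.smul (hg : IsGramEigenvector J μ g) (c : 𝕜) :
    IsGramEigenvector J μ (c • g) := fun h => by
  rw [inner_smul_right, hg h, map_smul, smul_comm, inner_smul_right _ _ c]

lemma IsGramEigenvector.inner_eq_zero (hg : IsGramEigenvector J μ g)
    (hh : IsGramEigenvector J ν h) (hμν : μ ≠ ν) : inner 𝕜 g h = 0 := by
  have hν : inner 𝕜 g h = ν * inner 𝕜 (J g) (J h) := by rw [hh g, inner_smul_right]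
  have hμ : inner 𝕜 g h = μ * inner 𝕜 (J g) (J h) := by
    rw [← inner_conj_symm, hg h, inner_smul_right, map_mul, inner_conj_symm, RCLike.conj_ofReal]
  have hJ : inner 𝕜 (J g) (J h) = 0 := by
    by_contra h0
    exact hμν (RCLike.ofReal_injective (mul_right_cancel₀ h0 (hμ.symm.trans hν)))
  rw [hν, hJ, mul_zero]

lemma hasEigenvalue_norm_of_isPositive [CompleteSpace G] {A : G →L[𝕜] G}
    (hA : IsCompactOperator A) (hpos : A.IsPositive) (h0 : A ≠ 0) :
    Module.End.HasEigenvalue (A : Module.End 𝕜 G) (‖A‖ : 𝕜) := by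
  have : Nontrivial G := by
    by_contra h
    rw [not_nontrivial_iff_subsingleton] at h
    exact h0 (Subsingleton.elim _ _)
  rw [hA.hasEigenvalue_iff_mem_spectrum (by simpa using h0)]
  by_contra hres
  obtain ⟨ε, hε, hle⟩ := A.rayleighQuotient_le_of_norm_mem_resolventSet (not_not.1 hres)
  have hnonneg : ∀ x, 0 ≤ A.rayleighQuotient x := fun x =>
    div_nonneg (hpos.re_inner_nonneg_left x) (sq_nonneg _)
  have hnorm : ‖A‖ ≤ ‖A‖ - ε := by
    conv_lhs => rw [A.norm_eq_iSup_rayleighQuotient hpos.isSymmetric]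
    exact ciSup_le fun x => (abs_of_nonneg (hnonneg x)).trans_le (hle x)
  linarith

variable [CompleteSpace G] [CompleteSpace L]

lemma isGramEigenvector_iff : IsGramEigenvector J μ g ↔ g = (μ : 𝕜) • J.adjoint (J g) := by
  have hadj : ∀ h, inner 𝕜 (J h) ((μ : 𝕜) • J g) = inner 𝕜 h ((μ : 𝕜) • J.adjoint (J g)) :=
    fun h => by
      rw [inner_smul_right, inner_smul_right, ContinuousLinearMap.adjoint_inner_right]
  constructor
  · exact fun hg => ext_inner_left 𝕜 fun h => (hg h).trans (hadj h)
  · exact fun hg h => (congrArg (inner 𝕜 h) hg).trans (hadj h).symm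

lemma exists_isGramEigenvector_of_adjoint_apply_eq_smul (hJg : J g ≠ 0) {r : 𝕜}
    (h : J.adjoint (J g) = r • g) : ∃ μ : ℝ, IsGramEigenvector J μ g := by
  have hJg' : (‖J g‖ : 𝕜) ≠ 0 := by simpa using hJg
  have hnorm : (‖J g‖ : 𝕜) ^ 2 = r * (‖g‖ : 𝕜) ^ 2 := by
    rw [← inner_self_eq_norm_sq_to_K, ← inner_self_eq_norm_sq_to_K, ← inner_smul_right, ← h,
      ContinuousLinearMap.adjoint_inner_right]
  refine ⟨‖g‖ ^ 2 / ‖J g‖ ^ 2, isGramEigenvector_iff.2 ?_⟩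
  rw [h, smul_smul]
  push_cast
  rw [div_mul_eq_mul_div, mul_comm, ← hnorm, div_self (pow_ne_zero 2 hJg'), one_smul]

lemma exists_linearIndependent_isGramEigenvector (hJ : IsCompactOperator J)
    (hinj : Function.Injective J) (hG : ¬ FiniteDimensional 𝕜 G) (k : ℕ) :
    ∃ g : Fin k → G, LinearIndependent 𝕜 g ∧ ∀ i, ∃ μ : ℝ, IsGramEigenvector J μ (g i) := by
  let S : Set G := {g | ∃ μ : ℝ, IsGramEigenvector J μ g}
  have hle : (⨆ r, Module.End.eigenspace ((J.adjoint ∘L J : G →L[𝕜] G) : Module.End 𝕜 G) r) ≤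
      Submodule.span 𝕜 S := by
    refine iSup_le fun r g hg => ?_
    rcases eq_or_ne g 0 with rfl | hg0
    · exact Submodule.zero_mem _
    · obtain ⟨μ, hμ⟩ := exists_isGramEigenvector_of_adjoint_apply_eq_smul
        ((map_ne_zero_iff J hinj).2 hg0) (Module.End.mem_eigenspace_iff.1 hg)
      exact Submodule.subset_span ⟨μ, hμ⟩
  have hbot : (Submodule.span 𝕜 S)ᗮ = ⊥ := le_bot_iff.1 <|
    (Submodule.orthogonal_le hle).trans_eq <|
      ContinuousLinearMap.orthogonalComplement_iSup_eigenspaces_eq_bot (hJ.clm_comp J.adjoint)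
        (ContinuousLinearMap.isPositive_adjoint_comp_self J).isSymmetric
  obtain ⟨b, hbS, hspan, hli⟩ := exists_linearIndependent 𝕜 S
  have hb : b.Infinite := by
    intro hfin
    have : FiniteDimensional 𝕜 (Submodule.span 𝕜 S) := hspan ▸ .span_of_finite 𝕜 hfin
    rw [Submodule.orthogonal_eq_bot_iff] at hbot
    rw [hbot] at this
    exact hG (Module.Finite.equiv Submodule.topEquiv)
  have := hb.to_subtype
  let emb : Fin k ↪ b := Fin.valEmbedding.trans (Infinite.natEmbedding b)
  exact ⟨fun i => emb i, hli.comp emb emb.injective, fun i => hbS (emb i).2⟩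

lemma exists_isGramEigenvector_forall_mul_norm_sq_le (hJ : IsCompactOperator J) (hJ0 : J ≠ 0) :
    ∃ m > 0, (∀ g, m * ‖J g‖ ^ 2 ≤ ‖g‖ ^ 2) ∧ ∃ g ≠ 0, IsGramEigenvector J m g := by
  let A : G →L[𝕜] G := J.adjoint ∘L J
  have hA : ‖A‖ = ‖J‖ * ‖J‖ := J.norm_adjoint_comp_self
  have hA0 : A ≠ 0 := by
    rw [← norm_ne_zero_iff, hA]
    exact mul_self_ne_zero.2 (norm_ne_zero_iff.2 hJ0)
  obtain ⟨g, hg, hg0⟩ := (hasEigenvalue_norm_of_isPositive (hJ.clm_comp J.adjoint)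
    (ContinuousLinearMap.isPositive_adjoint_comp_self J) hA0).exists_hasEigenvector
  have hAg : J.adjoint (J g) = (‖A‖ : 𝕜) • g := Module.End.mem_eigenspace_iff.1 hg
  have hpos : 0 < ‖A‖ := norm_pos_iff.2 hA0
  refine ⟨‖A‖⁻¹, inv_pos.2 hpos, fun h => ?_, g, hg0, isGramEigenvector_iff.2 ?_⟩
  · rw [inv_mul_le_iff₀ hpos, hA, ← sq, ← mul_pow]
    gcongr
    exact J.le_opNorm h
  · rw [hAg, smul_smul, RCLike.ofReal_inv, inv_mul_cancel₀ (by simpa using hA0), one_smul]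

lemma exists_tendsto_subseq_isGramEigenvector (hJ : IsCompactOperator J) {μ : ℕ → ℝ} {g : ℕ → G}
    (hμ : Tendsto μ atTop (𝓝 m)) (hg : ∀ n, IsGramEigenvector J (μ n) (g n))
    (hnorm : ∀ n, ‖g n‖ ≤ 1) :
    ∃ (g₀ : G) (φ : ℕ → ℕ), StrictMono φ ∧ Tendsto (g ∘ φ) atTop (𝓝 g₀) ∧
      IsGramEigenvector J m g₀ := by
  obtain ⟨K, hK, hsub⟩ := hJ.image_closedBall_subset_compact (f := (J : G →ₗ[𝕜] L)) 1
  obtain ⟨y, -, φ, hφ, hy⟩ := hK.tendsto_subseq (x := fun n => J (g n)) fun n =>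
    hsub ⟨g n, by simpa using hnorm n, rfl⟩
  have hlim : Tendsto (g ∘ φ) atTop (𝓝 ((m : 𝕜) • J.adjoint y)) := by
    have hright : Tendsto (fun n => (μ (φ n) : 𝕜) • J.adjoint (J (g (φ n)))) atTop
        (𝓝 ((m : 𝕜) • J.adjoint y)) :=
      ((RCLike.continuous_ofReal.tendsto m).comp (hμ.comp hφ.tendsto_atTop)).smul
        ((J.adjoint.continuous.tendsto y).comp hy)
    exact hright.congr fun n => (isGramEigenvector_iff.1 (hg (φ n))).symm
  have hJy : J ((m : 𝕜) • J.adjoint y) = y :=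
    tendsto_nhds_unique ((J.continuous.tendsto _).comp hlim) hy
  exact ⟨_, φ, hφ, hlim, isGramEigenvector_iff.2 (by rw [hJy])⟩

/-- Otherwise unit eigenvectors for eigenvalues tending to `m` would subconverge to a unit
eigenvector for `m`, to which they are all orthogonal. -/
lemma exists_gramEigenvalue_gap (hJ : IsCompactOperator J) (m : ℝ) :
    ∃ δ > 0, ∀ (μ : ℝ) (g : G), g ≠ 0 → IsGramEigenvector J μ g → |μ - m| < δ → μ = m := by
  by_contra! hacc
  have hseq : ∀ n : ℕ, ∃ (μ : ℝ) (g : G), ‖g‖ = 1 ∧ IsGramEigenvector J μ g ∧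
      |μ - m| < 1 / ((n : ℝ) + 1) ∧ μ ≠ m := fun n => by
    obtain ⟨μ, g, hg0, hg, hlt, hne⟩ := hacc (1 / ((n : ℝ) + 1)) (by positivity)
    exact ⟨μ, ((‖g‖ : 𝕜)⁻¹) • g, norm_smul_inv_norm hg0, hg.smul _, hlt, hne⟩
  choose μ g hnorm hg hlt hne using hseq
  have hμ : Tendsto μ atTop (𝓝 m) := tendsto_iff_dist_tendsto_zero.2 <|
    squeeze_zero (fun _ => dist_nonneg) (fun n => (hlt n).le)
      tendsto_one_div_add_atTop_nhds_zero_nat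
  obtain ⟨g₀, φ, -, hlim, hg₀⟩ :=
    exists_tendsto_subseq_isGramEigenvector hJ hμ hg fun n => (hnorm n).le
  have horth : inner 𝕜 g₀ g₀ = 0 := tendsto_nhds_unique (hlim.inner tendsto_const_nhds) <| by
    simp [fun n => (hg (φ n)).inner_eq_zero hg₀ (hne (φ n))]
  have hnorm₀ : ‖g₀‖ = 1 := tendsto_nhds_unique hlim.norm (by simp [hnorm])
  simp [inner_self_eq_zero.1 horth] at hnorm₀

lemma isGramEigenvector_of_forall_mul_norm_sq_le (hm : ∀ g, m * ‖J g‖ ^ 2 ≤ ‖g‖ ^ 2)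
    (hg : ‖g‖ ^ 2 ≤ m * ‖J g‖ ^ 2) : IsGramEigenvector J m g := by
  rcases eq_or_ne g 0 with rfl | hg0
  · exact fun h => by simp
  have hpos : 0 < m * ‖J g‖ ^ 2 := (by positivity : 0 < ‖g‖ ^ 2).trans_le hg
  have hm0 : 0 < m := pos_of_mul_pos_left hpos (sq_nonneg _)
  let A : G →L[𝕜] G := J.adjoint ∘L J
  have hA : ∀ h, A.reApplyInnerSelf h = ‖J h‖ ^ 2 := fun h => by
    rw [ContinuousLinearMap.reApplyInnerSelf_apply, ContinuousLinearMap.comp_apply,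
      ContinuousLinearMap.adjoint_inner_left, inner_self_eq_norm_sq]
  have hmax : IsMaxOn A.reApplyInnerSelf (Metric.sphere 0 ‖g‖) g := fun h hh => by
    rw [mem_sphere_zero_iff_norm] at hh
    rw [Set.mem_ofPred_eq, hA, hA, ← mul_le_mul_iff_right₀ hm0]
    exact (hm h).trans (hh ▸ hg)
  have hAg : A g = (A.rayleighQuotient g : 𝕜) • g :=
    (ContinuousLinearMap.isPositive_adjoint_comp_self J).isSelfAdjoint.eq_smul_self_of_isLocalExtrOn
      (Or.inr hmax.localize)
  have hquot : m * A.rayleighQuotient g = 1 := by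
    rw [ContinuousLinearMap.rayleighQuotient, hA, ← mul_div_assoc, (hm g).antisymm hg,
      div_self (by positivity)]
  rw [isGramEigenvector_iff]
  calc g = (m : 𝕜) • (A.rayleighQuotient g : 𝕜) • g := by
        rw [smul_smul, ← RCLike.ofReal_mul, hquot, RCLike.ofReal_one, one_smul]
    _ = (m : 𝕜) • J.adjoint (J g) := by rw [← hAg, ContinuousLinearMap.comp_apply]

end Gram

/-! ### The Volterra operator -/

section Volterra

open Set
open scoped BoundedContinuousFunction

variable {ℓ : ℝ}

lemma intervalIntegrable_L2Interval (g : L2Interval ℓ) {x y : ℝ} (hx : x ∈ Icc 0 ℓ)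
    (hy : y ∈ Icc 0 ℓ) : IntervalIntegrable g volume x y :=
  ((integrableOn_L2Interval g).mono_set (uIcc_subset_Icc hx hy)).intervalIntegrable

lemma norm_intervalIntegral_L2Interval_le (g : L2Interval ℓ) {x y : ℝ} (hx : x ∈ Icc 0 ℓ)
    (hy : y ∈ Icc 0 ℓ) : ‖∫ t in x..y, g t‖ ≤ √|y - x| * ‖g‖ := by
  wlog hxy : x ≤ y generalizing x y
  · rw [intervalIntegral.integral_symm, norm_neg, abs_sub_comm]
    exact this hy hx (le_of_not_ge hxy)
  have hsub : Ioc x y ⊆ Icc 0 ℓ := fun t ht => ⟨hx.1.trans ht.1.le, ht.2.trans hy.2⟩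
  have hfin : (volume.restrict (Icc 0 ℓ)) (Ioc x y) ≠ ⊤ := measure_ne_top _ _
  have hinner : inner ℂ (indicatorConstLp 2 measurableSet_Ioc hfin (1 : ℂ)) g =
      ∫ t in x..y, g t := by
    rw [L2.inner_indicatorConstLp_one, Measure.restrict_restrict measurableSet_Ioc,
      inter_eq_self_of_subset_left hsub, intervalIntegral.integral_of_le hxy]
  rw [← hinner]
  refine (norm_inner_le_norm _ _).trans (mul_le_mul_of_nonneg_right (le_of_eq ?_) (norm_nonneg g))
  rw [norm_indicatorConstLp (by norm_num) (by norm_num), norm_one, one_mul, measureReal_def,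
    Measure.restrict_apply measurableSet_Ioc, inter_eq_self_of_subset_left hsub, Real.volume_Ioc,
    ENNReal.toReal_ofReal (sub_nonneg.2 hxy), abs_of_nonneg (sub_nonneg.2 hxy), Real.sqrt_eq_rpow]
  norm_num

lemma norm_primitive_L2Interval_le (g : L2Interval ℓ) {x : ℝ} (hx : x ∈ Icc 0 ℓ) :
    ‖∫ t in (0 : ℝ)..x, g t‖ ≤ √ℓ * ‖g‖ := by
  refine (norm_intervalIntegral_L2Interval_le g ⟨le_rfl, hx.1.trans hx.2⟩ hx).trans ?_
  rw [sub_zero, abs_of_nonneg hx.1]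
  gcongr
  exact hx.2

/-- The primitive vanishing at `0`, as a continuous linear map into the continuous functions. -/
noncomputable def primitiveBCF (hℓ : 0 ≤ ℓ) : L2Interval ℓ →L[ℂ] (Icc (0 : ℝ) ℓ →ᵇ ℂ) :=
  LinearMap.mkContinuous
    { toFun := fun g => BoundedContinuousFunction.mkOfCompact
        ⟨fun x => ∫ t in (0 : ℝ)..x, g t, continuousOn_iff_continuous_domRestrict.1
          (continuousOn_intervalIntegral_Icc hℓ (integrableOn_L2Interval g))⟩
      map_add' := fun g h => by
        ext x
        have hint : ∀ f : L2Interval ℓ, IntervalIntegrable f volume 0 x := fun f =>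
          intervalIntegrable_L2Interval f ⟨le_rfl, hℓ⟩ x.2
        exact (intervalIntegral_congr_ae_restrict_Icc (Lp.coeFn_add g h) x.2).trans
          (intervalIntegral.integral_add (hint g) (hint h))
      map_smul' := fun c g => by
        ext x
        exact (intervalIntegral_congr_ae_restrict_Icc (Lp.coeFn_smul c g) x.2).trans
          (intervalIntegral.integral_smul c g) }
    (√ℓ) fun g => (BoundedContinuousFunction.norm_le (by positivity)).2 fun x =>
      norm_primitive_L2Interval_le g x.2

lemma primitiveBCF_apply (hℓ : 0 ≤ ℓ) (g : L2Interval ℓ) (x : Icc (0 : ℝ) ℓ) :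
    primitiveBCF hℓ g x = ∫ t in (0 : ℝ)..x, g t := rfl

lemma isCompactOperator_primitiveBCF (hℓ : 0 ≤ ℓ) : IsCompactOperator (primitiveBCF hℓ) := by
  refine (isCompactOperator_iff_isCompact_closure_image_closedBall
    (primitiveBCF hℓ : L2Interval ℓ →ₗ[ℂ] (Icc (0 : ℝ) ℓ →ᵇ ℂ)) one_pos).2 ?_
  refine BoundedContinuousFunction.arzela_ascoli (Metric.closedBall 0 (√ℓ))
    (isCompact_closedBall _ _) _ ?_
    (Metric.equicontinuous_of_continuity_modulus (fun r => √|r|) ?_ _ ?_)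
  · rintro _ x ⟨g, hg, rfl⟩
    rw [mem_closedBall_zero_iff] at hg ⊢
    exact (norm_primitive_L2Interval_le g x.2).trans
      (mul_le_of_le_one_right (Real.sqrt_nonneg ℓ) hg)
  · have hcont : Continuous fun r : ℝ => √|r| := by fun_prop
    simpa using hcont.tendsto 0
  · rintro x y ⟨_, g, hg, rfl⟩
    rw [mem_closedBall_zero_iff] at hg
    have hdiff : primitiveBCF hℓ g x - primitiveBCF hℓ g y = ∫ t in y..x, g t :=
      intervalIntegral.integral_interval_sub_left
        (intervalIntegrable_L2Interval g ⟨le_rfl, hℓ⟩ x.2)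
        (intervalIntegrable_L2Interval g ⟨le_rfl, hℓ⟩ y.2)
    calc dist (primitiveBCF hℓ g x) (primitiveBCF hℓ g y)
        ≤ √|(x : ℝ) - y| * ‖g‖ := by
          rw [dist_eq_norm, hdiff]
          exact norm_intervalIntegral_L2Interval_le g y.2 x.2
      _ ≤ √|(x : ℝ) - y| := mul_le_of_le_one_right (Real.sqrt_nonneg _) hg
      _ = √|dist x y| := by rw [Subtype.dist_eq, Real.dist_eq, abs_abs]

/-- The class in `L²(0, ℓ)` of a continuous function on `[0, ℓ]`. -/
noncomputable def bcfToLp (hℓ : 0 ≤ ℓ) : (Icc (0 : ℝ) ℓ →ᵇ ℂ) →L[ℂ] L2Interval ℓ :=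
  (BoundedContinuousFunction.toLp 2 (volume.restrict (Icc 0 ℓ)) ℂ) ∘L
    LinearMap.mkContinuous
      { toFun := fun g => g.compContinuous ⟨projIcc 0 ℓ hℓ, continuous_projIcc⟩
        map_add' := fun _ _ => rfl
        map_smul' := fun _ _ => rfl }
      1 fun g => by
        rw [one_mul]
        exact (BoundedContinuousFunction.norm_le (norm_nonneg g)).2 fun x => g.norm_coe_le_norm _

/-- The Volterra operator on `L²(0, ℓ)`. -/
noncomputable def volterra (hℓ : 0 ≤ ℓ) : L2Interval ℓ →L[ℂ] L2Interval ℓ :=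
  bcfToLp hℓ ∘L primitiveBCF hℓ

lemma isCompactOperator_volterra (hℓ : 0 ≤ ℓ) : IsCompactOperator (volterra hℓ) :=
  (isCompactOperator_primitiveBCF hℓ).clm_comp (bcfToLp hℓ)

lemma coeFn_volterra (hℓ : 0 ≤ ℓ) (g : L2Interval ℓ) :
    volterra hℓ g =ᵐ[volume.restrict (Icc 0 ℓ)] fun x => ∫ t in (0 : ℝ)..x, g t := by
  have hcoe : volterra hℓ g =ᵐ[volume.restrict (Icc 0 ℓ)]
      fun x => primitiveBCF hℓ g (projIcc 0 ℓ hℓ x) :=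
    BoundedContinuousFunction.coeFn_toLp (p := 2) (𝕜 := ℂ) (volume.restrict (Icc 0 ℓ)) _
  filter_upwards [hcoe, ae_restrict_mem measurableSet_Icc] with x hx hmem
  rw [hx, primitiveBCF_apply, projIcc_of_mem hℓ hmem]

/-- The integral over `(0, ℓ)` as a continuous functional on `L²(0, ℓ)`. -/
noncomputable def integralCLM (hℓ : 0 ≤ ℓ) : L2Interval ℓ →L[ℂ] ℂ :=
  BoundedContinuousFunction.evalCLM ℂ (⟨ℓ, hℓ, le_rfl⟩ : Icc (0 : ℝ) ℓ) ∘L primitiveBCF hℓ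

end Volterra

/-! ### The form domain -/

lemma isCompactOperator_pi {ι M : Type*} [Finite ι] [TopologicalSpace M] [Zero M] {N : ι → Type*}
    [∀ i, TopologicalSpace (N i)] {f : ∀ i, M → N i} (hf : ∀ i, IsCompactOperator (f i)) :
    IsCompactOperator fun x i => f i x := by
  choose K hK hfK using hf
  refine ⟨Set.univ.pi K, isCompact_univ_pi hK, ?_⟩
  have hpre : (fun x i => f i x) ⁻¹' Set.univ.pi K = ⋂ i, f i ⁻¹' K i := by
    ext x; simp
  rw [hpre]
  exact Filter.iInter_mem.2 hfK

namespace QuantumGraph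

variable (Γ : QuantumGraph)

/-- The space of functions on the vertices that vanish at the Dirichlet vertices. -/
def vertexSpace : Submodule ℂ (Γ.V → ℂ) where
  carrier := {c | ∀ v ∈ Γ.dir, c v = 0}
  add_mem' := fun ha hb v hv => by rw [Pi.add_apply, ha v hv, hb v hv, add_zero]
  zero_mem' := fun _ _ => rfl
  smul_mem' := fun a c hc v hv => by rw [Pi.smul_apply, hc v hv, smul_zero]

/-- The coboundary map, which sends a function on the vertices to its increments along the edges. -/
noncomputable def coboundary : Γ.vertexSpace →ₗ[ℂ] (Γ.E → ℂ) where
  toFun := fun c e => c.1 (Γ.tgt e) - c.1 (Γ.src e)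
  map_add' := fun _ _ => funext fun _ => add_sub_add_comm _ _ _ _
  map_smul' := fun a _ => funext fun _ => (smul_sub a _ _).symm

lemma coboundary_apply (c : Γ.vertexSpace) (e : Γ.E) :
    Γ.coboundary c e = c.1 (Γ.tgt e) - c.1 (Γ.src e) := rfl

/-- The integrals of an `L²` function over the edges. -/
noncomputable def edgeIntegrals : Γ.L2 →L[ℂ] (Γ.E → ℂ) :=
  ContinuousLinearMap.pi fun e => integralCLM (Γ.len_pos e).le ∘L PiLp.proj 2 _ e

lemma edgeIntegrals_apply (g : Γ.L2) (e : Γ.E) :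
    Γ.edgeIntegrals g e = ∫ t in (0 : ℝ)..(Γ.len e), g e t := rfl

/-- The space of derivatives of the functions in `H¹₀(Γ, dir)`: those `L²` functions whose
integrals over the edges are the increments of a function on the vertices that vanishes on `dir`. -/
noncomputable def derivSpace : Submodule ℂ Γ.L2 :=
  (LinearMap.range Γ.coboundary).comap (Γ.edgeIntegrals : Γ.L2 →ₗ[ℂ] (Γ.E → ℂ))

variable {Γ}

lemma mem_derivSpace {g : Γ.L2} :
    g ∈ Γ.derivSpace ↔ ∃ c, Γ.coboundary c = Γ.edgeIntegrals g := Iff.rfl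

lemma isClosed_derivSpace : IsClosed (Γ.derivSpace : Set Γ.L2) :=
  (Submodule.closed_of_finiteDimensional (LinearMap.range Γ.coboundary)).preimage
    Γ.edgeIntegrals.continuous

instance : CompleteSpace Γ.derivSpace := isClosed_derivSpace.completeSpace_coe

lemma ker_coboundary (hc : Γ.IsConnected) (hd : Γ.dir.Nonempty) :
    LinearMap.ker Γ.coboundary = ⊥ := by
  rw [LinearMap.ker_eq_bot']
  intro c hcobd
  obtain ⟨w, hw⟩ := hd
  have hedge : ∀ e, c.1 (Γ.tgt e) = c.1 (Γ.src e) := fun e => sub_eq_zero.1 (congrFun hcobd e)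
  suffices hzero : ∀ v, c.1 v = 0 from Subtype.ext (funext hzero)
  intro v
  obtain ⟨p⟩ := hc.preconnected v w
  induction p with
  | nil => exact c.2 _ hw
  | cons hadj _ ih =>
    rcases ((SimpleGraph.fromRel_adj _ _ _).1 hadj).2 with ⟨e, rfl, rfl⟩ | ⟨e, rfl, rfl⟩
    · rw [← hedge e, ih hw]
    · rw [hedge e, ih hw]

section Connected

variable (hc : Γ.IsConnected) (hd : Γ.dir.Nonempty)

/-- A linear left inverse of the coboundary map. -/
noncomputable def vertexValues : (Γ.E → ℂ) →ₗ[ℂ] Γ.vertexSpace :=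
  (LinearMap.exists_leftInverse_of_injective _ (ker_coboundary hc hd)).choose

lemma vertexValues_coboundary (c : Γ.vertexSpace) : vertexValues hc hd (Γ.coboundary c) = c :=
  LinearMap.congr_fun
    (LinearMap.exists_leftInverse_of_injective _ (ker_coboundary hc hd)).choose_spec c

/-- The value at the vertex `v` of the function in `H¹₀(Γ, dir)` with a given derivative. -/
noncomputable def vertexValueCLM (v : Γ.V) : Γ.L2 →L[ℂ] ℂ :=
  LinearMap.toContinuousLinearMap
    (LinearMap.proj v ∘ₗ Γ.vertexSpace.subtype ∘ₗ vertexValues hc hd) ∘L Γ.edgeIntegrals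

lemma vertexValueCLM_apply_of_coboundary_eq {c : Γ.vertexSpace} {g : Γ.L2}
    (h : Γ.coboundary c = Γ.edgeIntegrals g) (v : Γ.V) : vertexValueCLM hc hd v g = c.1 v := by
  change (vertexValues hc hd (Γ.edgeIntegrals g)).1 v = c.1 v
  rw [← h, vertexValues_coboundary]

/-- The restriction to the edge `e` of the function in `H¹₀(Γ, dir)` with a given derivative. -/
noncomputable def antiderivEdge (e : Γ.E) : Γ.L2 →L[ℂ] L2Interval (Γ.len e) :=
  Lp.constL 2 (volume.restrict (Set.Icc 0 (Γ.len e))) ℂ ∘L vertexValueCLM hc hd (Γ.src e) +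
    volterra (Γ.len_pos e).le ∘L PiLp.proj 2 _ e

lemma isCompactOperator_antiderivEdge (e : Γ.E) : IsCompactOperator (antiderivEdge hc hd e) := by
  have hvalue : IsCompactOperator (vertexValueCLM hc hd (Γ.src e)) :=
    isCompactOperator_of_locallyCompactSpace_dom _
  exact (hvalue.clm_comp (Lp.constL 2 (volume.restrict (Set.Icc 0 (Γ.len e))) ℂ)).add
    ((isCompactOperator_volterra (Γ.len_pos e).le).comp_clm
      (PiLp.proj 2 (fun e : Γ.E => L2Interval (Γ.len e)) e))

lemma coeFn_antiderivEdge (e : Γ.E) (g : Γ.L2) :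
    antiderivEdge hc hd e g =ᵐ[volume.restrict (Set.Icc 0 (Γ.len e))]
      primitiveFrom (vertexValueCLM hc hd (Γ.src e) g) (g e) := by
  set a := vertexValueCLM hc hd (Γ.src e) g
  have hdef : antiderivEdge hc hd e g =
    Lp.const 2 (volume.restrict (Set.Icc 0 (Γ.len e))) a + volterra (Γ.len_pos e).le (g e) := rfl
  rw [hdef]
  filter_upwards [Lp.coeFn_add (Lp.const 2 (volume.restrict (Set.Icc 0 (Γ.len e))) a)
    (volterra (Γ.len_pos e).le (g e)), Lp.coeFn_const 2 (volume.restrict (Set.Icc 0 (Γ.len e))) a,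
    coeFn_volterra (Γ.len_pos e).le (g e)] with x hadd hconst hvolterra
  rw [hadd, Pi.add_apply, hconst, hvolterra]
  rfl

/-- The function in `H¹₀(Γ, dir)` with a given derivative. -/
noncomputable def antideriv : Γ.L2 →L[ℂ] Γ.L2 :=
  ((PiLp.continuousLinearEquiv 2 ℂ fun e : Γ.E => L2Interval (Γ.len e)).symm : _ →L[ℂ] Γ.L2) ∘L
    ContinuousLinearMap.pi (antiderivEdge hc hd)

lemma isCompactOperator_antideriv : IsCompactOperator (antideriv hc hd) := by
  have hpi : IsCompactOperator fun g e => antiderivEdge hc hd e g :=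
    isCompactOperator_pi (isCompactOperator_antiderivEdge hc hd)
  exact hpi.clm_comp
    ((PiLp.continuousLinearEquiv 2 ℂ fun e : Γ.E => L2Interval (Γ.len e)).symm : _ →L[ℂ] Γ.L2)

lemma coeFn_antideriv {c : Γ.vertexSpace} {g : Γ.L2} (h : Γ.coboundary c = Γ.edgeIntegrals g)
    (e : Γ.E) : antideriv hc hd g e =ᵐ[volume.restrict (Set.Icc 0 (Γ.len e))]
      primitiveFrom (c.1 (Γ.src e)) (g e) := by
  rw [← vertexValueCLM_apply_of_coboundary_eq hc hd h]
  exact coeFn_antiderivEdge hc hd e g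

lemma isH10_iff_antideriv {f g : Γ.L2} :
    Γ.IsH10 f g ↔ g ∈ Γ.derivSpace ∧ f = antideriv hc hd g := by
  rw [isH10_iff_exists_isPrimitiveWithValues]
  constructor
  · rintro ⟨c, hdir, hprim⟩
    have hcobd : Γ.coboundary ⟨c, hdir⟩ = Γ.edgeIntegrals g :=
      funext fun e => sub_eq_iff_eq_add'.2 (hprim e).2.symm
    refine ⟨⟨_, hcobd⟩, ?_⟩
    ext e : 1
    exact Lp.ext ((hprim e).1.trans (coeFn_antideriv hc hd hcobd e).symm)
  · rintro ⟨hg, rfl⟩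
    obtain ⟨c, hcobd⟩ := mem_derivSpace.1 hg
    refine ⟨c.1, c.2, fun e => ⟨coeFn_antideriv hc hd hcobd e, ?_⟩⟩
    rw [primitiveFrom, ← edgeIntegrals_apply, ← hcobd, coboundary_apply, add_sub_cancel]

/-- The embedding of `H¹₀(Γ, dir)` into `L²(Γ)`, where a function is represented by its derivative.
In this form the norm of `H¹₀(Γ, dir)` is the square root of the Dirichlet integral. -/
noncomputable def formEmbedding : Γ.derivSpace →L[ℂ] Γ.L2 :=
  antideriv hc hd ∘L Γ.derivSpace.subtypeL

lemma isH10_formEmbedding (g : Γ.derivSpace) : Γ.IsH10 (formEmbedding hc hd g) g :=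
  (isH10_iff_antideriv hc hd).2 ⟨g.2, rfl⟩

lemma exists_formEmbedding_eq_of_isH10 {f f' : Γ.L2} (h : Γ.IsH10 f f') :
    ∃ g : Γ.derivSpace, (g : Γ.L2) = f' ∧ formEmbedding hc hd g = f := by
  obtain ⟨hmem, hf⟩ := (isH10_iff_antideriv hc hd).1 h
  exact ⟨⟨f', hmem⟩, rfl, hf.symm⟩

lemma isCompactOperator_formEmbedding : IsCompactOperator (formEmbedding hc hd) :=
  (isCompactOperator_antideriv hc hd).comp_clm Γ.derivSpace.subtypeL

lemma formEmbedding_injective : Function.Injective (formEmbedding hc hd) := by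
  rw [injective_iff_map_eq_zero]
  intro g hg
  have hweak := (isH10_formEmbedding hc hd g).1
  rw [hg] at hweak
  ext e : 2
  exact Lp.ext (((hweak e).ae_eq_zero (integrableOn_L2Interval _) (Lp.coeFn_zero _ _ _)).trans
    (Lp.coeFn_zero _ _ _).symm)

lemma isEigenvector_iff_isGramEigenvector {μ : ℝ} {f : Γ.L2} :
    Γ.IsEigenvector μ f ↔ ∃ g : Γ.derivSpace,
      formEmbedding hc hd g = f ∧ IsGramEigenvector (formEmbedding hc hd) μ g := by
  constructor
  · rintro ⟨f', hf, hform⟩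
    obtain ⟨g, rfl, rfl⟩ := exists_formEmbedding_eq_of_isH10 hc hd hf
    exact ⟨g, rfl, fun h => hform _ _ (isH10_formEmbedding hc hd h)⟩
  · rintro ⟨g, rfl, hg⟩
    refine ⟨g, isH10_formEmbedding hc hd g, fun u u' hu => ?_⟩
    obtain ⟨h, rfl, rfl⟩ := exists_formEmbedding_eq_of_isH10 hc hd hu
    exact hg h

end Connected

end QuantumGraph

/-! ### Continuous functions as elements of `L²(Γ)` -/

lemma memLp_restrict_Icc_of_continuous {ℓ : ℝ} {F : ℝ → ℂ} (hF : Continuous F) :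
    MemLp F 2 (volume.restrict (Set.Icc 0 ℓ)) := by
  obtain ⟨C, hC⟩ :=
    (isCompact_Icc (a := (0 : ℝ)) (b := ℓ)).exists_bound_of_continuousOn hF.continuousOn
  exact MemLp.of_bound hF.aestronglyMeasurable C
    ((ae_restrict_mem measurableSet_Icc).mono fun x hx => hC x hx)

namespace QuantumGraph

section ContToL2

variable {Γ : QuantumGraph}

variable (Γ) in
/-- The element of `L²(Γ)` given by a continuous function on each edge. -/
noncomputable def contToL2 : (Γ.E → C(ℝ, ℂ)) →ₗ[ℂ] Γ.L2 where
  toFun := fun F =>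
    WithLp.toLp 2 fun e => MemLp.toLp (F e) (memLp_restrict_Icc_of_continuous (F e).continuous)
  map_add' := fun _ _ => rfl
  map_smul' := fun _ _ => rfl

lemma coeFn_contToL2 (F : Γ.E → C(ℝ, ℂ)) (e : Γ.E) :
    Γ.contToL2 F e =ᵐ[volume.restrict (Set.Icc 0 (Γ.len e))] F e :=
  MemLp.coeFn_toLp (memLp_restrict_Icc_of_continuous (F e).continuous)

lemma eq_contToL2 {f : Γ.L2} {F : Γ.E → C(ℝ, ℂ)}
    (h : ∀ e, f e =ᵐ[volume.restrict (Set.Icc 0 (Γ.len e))] F e) : f = Γ.contToL2 F := by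
  ext e : 1
  exact Lp.ext ((h e).trans (coeFn_contToL2 F e).symm)

lemma contToL2_eq_zero_iff {F : Γ.E → C(ℝ, ℂ)} :
    Γ.contToL2 F = 0 ↔ ∀ e, ∀ x ∈ Set.Icc 0 (Γ.len e), F e x = 0 := by
  constructor
  · intro h e
    have hF := coeFn_contToL2 F e
    rw [h] at hF
    exact Measure.eqOn_Icc_of_ae_eq volume (Γ.len_pos e).ne
      (hF.symm.trans (Lp.coeFn_zero _ _ _)) (F e).continuous.continuousOn continuousOn_const
  · intro h
    refine (eq_contToL2 fun e => (Lp.coeFn_zero _ _ _).trans ?_).symm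
    filter_upwards [ae_restrict_mem measurableSet_Icc] with x hx
    rw [h e x hx, Pi.zero_apply]

lemma not_finiteDimensional_L2 : ¬ FiniteDimensional ℂ Γ.L2 := by
  intro hfin
  let P : Polynomial ℂ →ₗ[ℂ] Γ.L2 := Γ.contToL2 ∘ₗ
    { toFun := fun p _ => ⟨fun x => p.eval (x : ℂ), p.continuous.comp Complex.continuous_ofReal⟩
      map_add' := fun p q => by ext; simp
      map_smul' := fun c p => by ext; simp }
  have hP : Function.Injective P := by
    rw [injective_iff_map_eq_zero]
    intro p hp
    let e : Γ.E := Classical.arbitrary Γ.E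
    refine Polynomial.eq_zero_of_infinite_isRoot p
      (((Set.Icc_infinite (Γ.len_pos e)).image Complex.ofReal_injective.injOn).mono ?_)
    rintro _ ⟨x, hx, rfl⟩
    exact contToL2_eq_zero_iff.1 hp e x hx
  exact Polynomial.not_finite (FiniteDimensional.of_injective P hP)

lemma not_finiteDimensional_derivSpace : ¬ FiniteDimensional ℂ Γ.derivSpace := by
  intro hfin
  let T : Γ.L2 →ₗ[ℂ] (Γ.E → ℂ) := Γ.edgeIntegrals
  have hle : LinearMap.ker T ≤ Γ.derivSpace := fun g hg =>
    mem_derivSpace.2 ⟨0, by rw [map_zero]; exact (LinearMap.mem_ker.1 hg).symm⟩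
  have hker : FiniteDimensional ℂ (LinearMap.ker T) := Submodule.finiteDimensional_of_le hle
  have hquot : FiniteDimensional ℂ (Γ.L2 ⧸ LinearMap.ker T) :=
    Module.Finite.equiv T.quotKerEquivRange.symm
  exact not_finiteDimensional_L2 (Γ := Γ) (Module.Finite.of_submodule_quotient (LinearMap.ker T))

end ContToL2

/-! ### The eigenvalues -/

section Eigenvalues

variable {Γ : QuantumGraph} {m μ t : ℝ} {f f' : Γ.L2} {j k : ℕ}

variable (Γ) in
/-- There are `k` linearly independent eigenfunctions with eigenvalues at most `t`: the `k`-th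
eigenvalue is the smallest such `t`. -/
def HasEigenvectorsLE (k : ℕ) (t : ℝ) : Prop :=
  ∃ f : Fin k → Γ.L2, LinearIndependent ℂ f ∧ ∀ i, ∃ μ : ℝ, μ ≤ t ∧ Γ.IsEigenvector μ (f i)

variable (Γ) in
/-- The Poincaré inequality on `H¹₀(Γ, dir)` with constant `m`. -/
def PoincareInequality (m : ℝ) : Prop := ∀ f f', Γ.IsH10 f f' → m * ‖f‖ ^ 2 ≤ ‖f'‖ ^ 2

lemma IsEigenvector.exists_norm_sq_eq (h : Γ.IsEigenvector μ f) :
    ∃ f', Γ.IsH10 f f' ∧ ‖f'‖ ^ 2 = μ * ‖f‖ ^ 2 := by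
  obtain ⟨f', hf, hform⟩ := h
  refine ⟨f', hf, ?_⟩
  have hself := hform f f' hf
  rw [inner_smul_right, inner_self_eq_norm_sq_to_K, inner_self_eq_norm_sq_to_K] at hself
  simp only [Complex.coe_algebraMap] at hself
  exact_mod_cast hself

lemma PoincareInequality.le_of_isEigenvector (hm : Γ.PoincareInequality m) (hf0 : f ≠ 0)
    (hf : Γ.IsEigenvector μ f) : m ≤ μ := by
  obtain ⟨f', hf', hnorm⟩ := hf.exists_norm_sq_eq
  exact le_of_mul_le_mul_right ((hm f f' hf').trans_eq hnorm) (by positivity)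

lemma HasEigenvectorsLE.mono (h : Γ.HasEigenvectorsLE k t) (hjk : j ≤ k) :
    Γ.HasEigenvectorsLE j t := by
  obtain ⟨f, hf, hft⟩ := h
  exact ⟨f ∘ Fin.castLE hjk, hf.comp _ (Fin.castLE_injective hjk), fun i => hft _⟩

lemma HasEigenvectorsLE.exists_isEigenvector_le (h : Γ.HasEigenvectorsLE k t) (hk : 1 ≤ k) :
    ∃ μ ≤ t, ∃ f ≠ 0, Γ.IsEigenvector μ f := by
  obtain ⟨f, hf, hft⟩ := h
  obtain ⟨μ, hμ, hfμ⟩ := hft ⟨0, hk⟩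
  exact ⟨μ, hμ, f _, hf.ne_zero _, hfμ⟩

variable (hc : Γ.IsConnected) (hd : Γ.dir.Nonempty)
include hc hd

lemma exists_hasEigenvectorsLE (k : ℕ) : ∃ t, Γ.HasEigenvectorsLE k t := by
  obtain ⟨g, hg, hgμ⟩ := exists_linearIndependent_isGramEigenvector
    (isCompactOperator_formEmbedding hc hd) (formEmbedding_injective hc hd)
    not_finiteDimensional_derivSpace k
  choose μ hμ using hgμ
  obtain ⟨t, ht⟩ := (Set.finite_range μ).bddAbove
  exact ⟨t, fun i => formEmbedding hc hd (g i),
    hg.map' (formEmbedding hc hd : Γ.derivSpace →ₗ[ℂ] Γ.L2)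
      (LinearMap.ker_eq_bot.2 (formEmbedding_injective hc hd)),
    fun i => ⟨μ i, ht ⟨i, rfl⟩, (isEigenvector_iff_isGramEigenvector hc hd).2 ⟨g i, rfl, hμ i⟩⟩⟩

lemma exists_poincareInequality_isEigenvector :
    ∃ m > 0, Γ.PoincareInequality m ∧ ∃ f ≠ 0, Γ.IsEigenvector m f := by
  have hinj := formEmbedding_injective hc hd
  have hne : formEmbedding hc hd ≠ 0 := by
    intro hzero
    rw [hzero] at hinj
    have : Subsingleton Γ.derivSpace := ⟨fun _ _ => hinj rfl⟩
    exact not_finiteDimensional_derivSpace (Γ := Γ) inferInstance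
  obtain ⟨m, hm, hle, g, hg0, hg⟩ :=
    exists_isGramEigenvector_forall_mul_norm_sq_le (isCompactOperator_formEmbedding hc hd) hne
  refine ⟨m, hm, fun f f' hf => ?_, formEmbedding hc hd g, (map_ne_zero_iff _ hinj).2 hg0,
    (isEigenvector_iff_isGramEigenvector hc hd).2 ⟨g, rfl, hg⟩⟩
  obtain ⟨g', rfl, rfl⟩ := exists_formEmbedding_eq_of_isH10 hc hd hf
  exact hle g'

lemma PoincareInequality.isEigenvector_of_norm_sq_le (hm : Γ.PoincareInequality m)
    (hf : Γ.IsH10 f f') (h : ‖f'‖ ^ 2 ≤ m * ‖f‖ ^ 2) : Γ.IsEigenvector m f := by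
  obtain ⟨g, rfl, rfl⟩ := exists_formEmbedding_eq_of_isH10 hc hd hf
  exact (isEigenvector_iff_isGramEigenvector hc hd).2 ⟨g, rfl,
    isGramEigenvector_of_forall_mul_norm_sq_le (fun g' => hm _ _ (isH10_formEmbedding hc hd g')) h⟩

lemma IsEigenvector.pos (hf : Γ.IsEigenvector μ f) (hf0 : f ≠ 0) : 0 < μ := by
  obtain ⟨m, hm, hpoincare, -⟩ := exists_poincareInequality_isEigenvector hc hd
  exact hm.trans_le (hpoincare.le_of_isEigenvector hf0 hf)

lemma exists_eigenvalue_gap (m : ℝ) :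
    ∃ δ > 0, ∀ (μ : ℝ) (f : Γ.L2), f ≠ 0 → Γ.IsEigenvector μ f → |μ - m| < δ → μ = m := by
  obtain ⟨δ, hδ, hgap⟩ := exists_gramEigenvalue_gap (isCompactOperator_formEmbedding hc hd) m
  refine ⟨δ, hδ, fun μ f hf0 hf => ?_⟩
  obtain ⟨g, rfl, hg⟩ := (isEigenvector_iff_isGramEigenvector hc hd).1 hf
  exact hgap μ g (fun hg0 => hf0 (by rw [hg0, map_zero])) hg

lemma eigenvalue_le (hk : 1 ≤ k) (h : Γ.HasEigenvectorsLE k t) : Γ.eigenvalue k ≤ t := by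
  refine csInf_le ⟨0, fun s (hs : Γ.HasEigenvectorsLE k s) => ?_⟩ h
  obtain ⟨μ, hμ, f, hf0, hf⟩ := hs.exists_isEigenvector_le hk
  exact (hf.pos hc hd hf0).le.trans hμ

lemma le_eigenvalue (h : ∀ s, Γ.HasEigenvectorsLE k s → t ≤ s) : t ≤ Γ.eigenvalue k :=
  le_csInf (exists_hasEigenvectorsLE hc hd k) h

lemma le_eigenvalue_of_forall_isEigenvector (hk : 1 ≤ k)
    (h : ∀ (μ : ℝ) (f : Γ.L2), f ≠ 0 → Γ.IsEigenvector μ f → t ≤ μ) : t ≤ Γ.eigenvalue k :=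
  le_eigenvalue hc hd fun s hs => by
    obtain ⟨μ, hμ, f, hf0, hf⟩ := hs.exists_isEigenvector_le hk
    exact (h μ f hf0 hf).trans hμ

lemma eigenvalue_mono (hj : 1 ≤ j) (hjk : j ≤ k) : Γ.eigenvalue j ≤ Γ.eigenvalue k :=
  le_eigenvalue hc hd fun _ hs => eigenvalue_le hc hd hj (hs.mono hjk)

lemma eigenvalue_pos (hk : 1 ≤ k) : 0 < Γ.eigenvalue k := by
  obtain ⟨m, hm, hpoincare, -⟩ := exists_poincareInequality_isEigenvector hc hd
  exact hm.trans_le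
    (le_eigenvalue_of_forall_isEigenvector hc hd hk fun _ _ => hpoincare.le_of_isEigenvector)

lemma one_le_ratio (hj : 1 ≤ j) (hjk : j ≤ k) : 1 ≤ Γ.ratio k j :=
  (one_le_div (eigenvalue_pos hc hd hj)).2 (eigenvalue_mono hc hd hj hjk)

lemma exists_linearIndependent_isEigenvector_of_ratio_eq_one (h : Γ.ratio k 1 = 1) :
    ∃ m > 0, Γ.PoincareInequality m ∧
      ∃ f : Fin k → Γ.L2, LinearIndependent ℂ f ∧ ∀ i, Γ.IsEigenvector m (f i) := by
  obtain ⟨m, hm, hpoincare, f₁, hf₁0, hf₁⟩ := exists_poincareInequality_isEigenvector hc hd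
  have hfirst : Γ.eigenvalue 1 ≤ m := eigenvalue_le hc hd le_rfl
    ⟨fun _ => f₁, linearIndependent_unique_iff.2 hf₁0, fun _ => ⟨m, le_rfl, hf₁⟩⟩
  have hkth : Γ.eigenvalue k = Γ.eigenvalue 1 :=
    (div_eq_one_iff_eq (eigenvalue_pos hc hd le_rfl).ne').1 h
  obtain ⟨δ, hδ, hgap⟩ := exists_eigenvalue_gap hc hd m
  obtain ⟨t, ⟨f, hf, hft⟩, htm⟩ := exists_lt_of_csInf_lt (exists_hasEigenvectorsLE hc hd k)
    (show Γ.eigenvalue k < m + δ by linarith)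
  refine ⟨m, hm, hpoincare, f, hf, fun i => ?_⟩
  obtain ⟨μ, hμt, hμ⟩ := hft i
  have hmμ := hpoincare.le_of_isEigenvector (hf.ne_zero i) hμ
  rwa [← hgap μ (f i) (hf.ne_zero i) hμ (abs_lt.2 ⟨by linarith, by linarith⟩)]

end Eigenvalues

end QuantumGraph

/-! ### Trigonometric solutions on an edge -/

/-- The function `x ↦ a cos (κ x) + b sin (κ x)`, the solution of `F'' = -κ² F` with `F 0 = a` and
`F' 0 = κ b`. -/
noncomputable def trig (κ : ℝ) (a b : ℂ) : C(ℝ, ℂ) where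
  toFun := fun x => a * (Real.cos (κ * x) : ℝ) + b * (Real.sin (κ * x) : ℝ)
  continuous_toFun := by fun_prop

section Trig

variable {κ ℓ : ℝ} {a b c : ℂ} {F G : ℝ → ℂ}

lemma trig_apply (κ : ℝ) (a b : ℂ) (x : ℝ) :
    trig κ a b x = a * (Real.cos (κ * x) : ℝ) + b * (Real.sin (κ * x) : ℝ) := rfl

@[simp] lemma trig_apply_zero (κ : ℝ) (a b : ℂ) : trig κ a b 0 = a := by simp [trig_apply]

@[simp] lemma trig_zero_zero (κ : ℝ) : trig κ 0 0 = 0 := by ext x; simp [trig_apply]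

lemma trig_neg_neg (κ : ℝ) (a b : ℂ) (x : ℝ) : trig κ (-a) (-b) x = -trig κ a b x := by
  simp only [trig_apply]
  ring

lemma hasDerivAt_ofReal_cos_mul (κ x : ℝ) :
    HasDerivAt (fun y => ((Real.cos (κ * y) : ℝ) : ℂ)) (-(κ * (Real.sin (κ * x) : ℝ)) : ℂ) x := by
  convert ((hasDerivAt_const_mul (x := x) κ).cos).ofReal_comp using 1
  push_cast
  ring

lemma hasDerivAt_ofReal_sin_mul (κ x : ℝ) :
    HasDerivAt (fun y => ((Real.sin (κ * y) : ℝ) : ℂ)) (κ * (Real.cos (κ * x) : ℝ) : ℂ) x := by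
  convert ((hasDerivAt_const_mul (x := x) κ).sin).ofReal_comp using 1
  push_cast
  ring

lemma hasDerivAt_trig (κ : ℝ) (a b : ℂ) (x : ℝ) :
    HasDerivAt (trig κ a b) (κ * trig κ b (-a) x) x := by
  refine (((hasDerivAt_ofReal_cos_mul κ x).const_mul a).add
    ((hasDerivAt_ofReal_sin_mul κ x).const_mul b)).congr_deriv ?_
  rw [trig_apply]
  ring

lemma ofReal_cos_sq_add_sin_sq (x : ℝ) :
    ((Real.cos x : ℝ) : ℂ) ^ 2 + ((Real.sin x : ℝ) : ℂ) ^ 2 = 1 := by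
  exact_mod_cast Real.cos_sq_add_sin_sq x

/-- The reason is that `F cos (κ x) - G sin (κ x)` and `F sin (κ x) + G cos (κ x)` are constant. -/
lemma eqOn_trig_of_hasDerivWithinAt (hF : ContinuousOn F (Set.Icc 0 ℓ))
    (hG : ContinuousOn G (Set.Icc 0 ℓ))
    (hF' : ∀ x ∈ Set.Ico 0 ℓ, HasDerivWithinAt F (κ * G x) (Set.Ici x) x)
    (hG' : ∀ x ∈ Set.Ico 0 ℓ, HasDerivWithinAt G (-(κ * F x)) (Set.Ici x) x) :
    Set.EqOn F (trig κ (F 0) (G 0)) (Set.Icc 0 ℓ) := by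
  intro x hx
  have hcos : Continuous fun y : ℝ => ((Real.cos (κ * y) : ℝ) : ℂ) := by fun_prop
  have hsin : Continuous fun y : ℝ => ((Real.sin (κ * y) : ℝ) : ℂ) := by fun_prop
  have hcos' : ∀ y, HasDerivWithinAt _ _ (Set.Ici y) y := fun y =>
    (hasDerivAt_ofReal_cos_mul κ y).hasDerivWithinAt
  have hsin' : ∀ y, HasDerivWithinAt _ _ (Set.Ici y) y := fun y =>
    (hasDerivAt_ofReal_sin_mul κ y).hasDerivWithinAt
  have hconst := constant_of_has_deriv_right_zero
    ((hF.mul hcos.continuousOn).sub (hG.mul hsin.continuousOn)) (fun y hy =>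
      (((hF' y hy).mul (hcos' y)).sub ((hG' y hy).mul (hsin' y))).congr_deriv (by ring)) x hx
  have hconst' := constant_of_has_deriv_right_zero
    ((hF.mul hsin.continuousOn).add (hG.mul hcos.continuousOn)) (fun y hy =>
      (((hF' y hy).mul (hsin' y)).add ((hG' y hy).mul (hcos' y))).congr_deriv (by ring)) x hx
  simp only [Pi.sub_apply, Pi.add_apply, Pi.mul_apply, mul_zero, Real.cos_zero, Real.sin_zero,
    Complex.ofReal_one, Complex.ofReal_zero, mul_one, sub_zero, zero_add] at hconst hconst'
  rw [trig_apply, ← hconst, ← hconst']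
  linear_combination -F x * ofReal_cos_sq_add_sin_sq (κ * x)

lemma hasDerivWithinAt_primitiveFrom (c : ℂ) (hG : ContinuousOn G (Set.Icc 0 ℓ)) {x : ℝ}
    (hx : x ∈ Set.Ico 0 ℓ) : HasDerivWithinAt (primitiveFrom c G) (G x) (Set.Ici x) x := by
  have hint : IntervalIntegrable G volume 0 x :=
    (hG.mono (Set.uIcc_of_le hx.1 ▸ Set.Icc_subset_Icc_right hx.2.le)).intervalIntegrable
  have hmem : Set.Icc 0 ℓ ∈ nhdsWithin x (Set.Ioi x) :=
    Icc_mem_nhdsGT_of_mem hx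
  exact (intervalIntegral.integral_hasDerivWithinAt_right hint
    (hG.stronglyMeasurableAtFilter_nhdsWithin measurableSet_Icc x |>.filter_mono
      (nhdsWithin_le_of_mem hmem))
    ((hG x ⟨hx.1, hx.2.le⟩).mono_of_mem_nhdsWithin hmem)).const_add c

lemma eqOn_trig_of_eqOn_primitiveFrom (hF : ContinuousOn F (Set.Icc 0 ℓ))
    (hG : ContinuousOn G (Set.Icc 0 ℓ))
    (hF' : Set.EqOn F (primitiveFrom a fun t => κ * G t) (Set.Icc 0 ℓ))
    (hG' : Set.EqOn G (primitiveFrom b fun t => -(κ * F t)) (Set.Icc 0 ℓ)) :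
    Set.EqOn F (trig κ a b) (Set.Icc 0 ℓ) := by
  intro x hx
  have hzero : (0 : ℝ) ∈ Set.Icc 0 ℓ := ⟨le_rfl, hx.1.trans hx.2⟩
  have hderiv : ∀ {H H' : ℝ → ℂ} {d : ℂ}, ContinuousOn H' (Set.Icc 0 ℓ) →
      Set.EqOn H (primitiveFrom d H') (Set.Icc 0 ℓ) →
      ∀ y ∈ Set.Ico 0 ℓ, HasDerivWithinAt H (H' y) (Set.Ici y) y := fun hH' hH y hy =>
    (hasDerivWithinAt_primitiveFrom _ hH' hy).congr_of_eventuallyEq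
      (Filter.eventually_of_mem (Icc_mem_nhdsGE_of_mem hy) hH) (hH ⟨hy.1, hy.2.le⟩)
  rw [eqOn_trig_of_hasDerivWithinAt (κ := κ) hF hG (hderiv (continuousOn_const.mul hG) hF')
    (hderiv (continuousOn_const.mul hF).neg hG') hx, hF' hzero, hG' hzero,
    primitiveFrom_zero_right, primitiveFrom_zero_right]

lemma mul_primitiveFrom (k c : ℂ) (g : ℝ → ℂ) (x : ℝ) :
    k * primitiveFrom c g x = primitiveFrom (k * c) (fun t => k * g t) x := by
  rw [primitiveFrom, primitiveFrom, mul_add, intervalIntegral.integral_const_mul]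

lemma star_primitiveFrom (c : ℂ) (g : ℝ → ℂ) (x : ℝ) :
    starRingEnd ℂ (primitiveFrom c g x) =
      primitiveFrom (starRingEnd ℂ c) (fun t => starRingEnd ℂ (g t)) x := by
  rw [primitiveFrom, primitiveFrom, map_add, intervalIntegral, intervalIntegral, map_sub,
    integral_conj, integral_conj]

lemma primitiveFrom_congr_ae {g₁ g₂ : ℝ → ℂ} (h : g₁ =ᵐ[volume.restrict (Set.Icc 0 ℓ)] g₂) (c : ℂ) :
    Set.EqOn (primitiveFrom c g₁) (primitiveFrom c g₂) (Set.Icc 0 ℓ) := fun _ hx =>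
  congrArg (c + ·) (intervalIntegral_congr_ae_restrict_Icc h hx)

/-- Elliptic regularity in dimension one: weak solutions of `u'' = -κ² u` are trigonometric. -/
lemma exists_ae_eq_trig_of_hasWeakDeriv {u u' : ℝ → ℂ} (hκ : κ ≠ 0) (hℓ : 0 < ℓ)
    (hu_int : IntegrableOn u (Set.Icc 0 ℓ)) (hu'_int : IntegrableOn u' (Set.Icc 0 ℓ))
    (hu : u =ᵐ[volume.restrict (Set.Icc 0 ℓ)] primitiveFrom c u')
    (hweak : QuantumGraph.HasWeakDeriv ℓ u' fun x => -(κ ^ 2 * u x)) :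
    ∃ b : ℂ, u' =ᵐ[volume.restrict (Set.Icc 0 ℓ)] (fun x => κ * trig κ b (-c) x) ∧
      Set.EqOn (primitiveFrom c u') (trig κ c b) (Set.Icc 0 ℓ) := by
  have hκ' : (κ : ℂ) ≠ 0 := Complex.ofReal_ne_zero.2 hκ
  obtain ⟨d, hd⟩ := hweak.exists_ae_eq_primitiveFrom hℓ hu'_int (hu_int.const_mul _).neg
  set b : ℂ := d / κ
  set F : ℝ → ℂ := primitiveFrom c u'
  set G : ℝ → ℂ := primitiveFrom b fun x => -(κ * u x)
  have hu'G : u' =ᵐ[volume.restrict (Set.Icc 0 ℓ)] fun x => κ * G x := by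
    refine hd.trans (Filter.Eventually.of_forall fun x => ?_)
    simp only [G, b, mul_primitiveFrom, mul_div_cancel₀ _ hκ', mul_neg, ← mul_assoc, sq]
    rfl
  have hF : ContinuousOn F (Set.Icc 0 ℓ) := continuousOn_primitiveFrom hℓ.le c hu'_int
  have hG : ContinuousOn G (Set.Icc 0 ℓ) :=
    continuousOn_primitiveFrom hℓ.le b (hu_int.const_mul _).neg
  have hF' : Set.EqOn F (primitiveFrom c fun t => κ * G t) (Set.Icc 0 ℓ) :=
    primitiveFrom_congr_ae hu'G c
  have hG' : Set.EqOn G (primitiveFrom b fun t => -(κ * F t)) (Set.Icc 0 ℓ) :=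
    primitiveFrom_congr_ae (hu.mono fun x hx => congrArg (fun z : ℂ => -((κ : ℂ) * z)) hx) b
  have hG_trig : Set.EqOn G (trig κ b (-c)) (Set.Icc 0 ℓ) := by
    refine eqOn_trig_of_eqOn_primitiveFrom (F := G) (G := -F) hG hF.neg (fun x hx => ?_)
      fun x hx => ?_
    · simpa only [Pi.neg_apply, mul_neg] using hG' hx
    · simpa only [Pi.neg_apply, mul_neg, neg_one_mul] using (congrArg (-1 * ·) (hF' hx)).trans
        (mul_primitiveFrom (-1) c _ x)
  refine ⟨b, ?_, eqOn_trig_of_eqOn_primitiveFrom hF hG hF' hG'⟩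
  filter_upwards [hu'G, ae_restrict_mem measurableSet_Icc] with x hx hmem
  rw [hx, hG_trig hmem]

lemma integral_conj_mul_trig (hℓ : 0 ≤ ℓ) (κ : ℝ) (a b : ℂ) {u u' : ℝ → ℂ}
    (hu' : IntegrableOn u' (Set.Icc 0 ℓ))
    (hu : u =ᵐ[volume.restrict (Set.Icc 0 ℓ)] primitiveFrom c u') :
    (∫ x in Set.Icc 0 ℓ, starRingEnd ℂ (u' x) * (κ * trig κ b (-a) x)) -
        κ ^ 2 * ∫ x in Set.Icc 0 ℓ, starRingEnd ℂ (u x) * trig κ a b x =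
      κ * (starRingEnd ℂ (primitiveFrom c u' ℓ) * trig κ b (-a) ℓ - starRingEnd ℂ c * b) := by
  have hderiv : ∀ x, HasDerivAt (fun x => κ * trig κ b (-a) x) (-(κ ^ 2 * trig κ a b x)) x :=
    fun x => ((hasDerivAt_trig κ b (-a) x).const_mul (κ : ℂ)).congr_deriv (by
      rw [trig_neg_neg]; ring)
  have hparts := setIntegral_deriv_smul_primitiveFrom hℓ (starRingEnd ℂ c)
    ((LinearIsometryEquiv.integrable_comp_iff Complex.conjLIE).2 hu') hderiv (by fun_prop)
  have hleft : ∫ x in Set.Icc 0 ℓ, -(κ ^ 2 * trig κ a b x) •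
      primitiveFrom (starRingEnd ℂ c) (fun t => starRingEnd ℂ (u' t)) x =
      -(κ ^ 2 * ∫ x in Set.Icc 0 ℓ, starRingEnd ℂ (u x) * trig κ a b x) := by
    rw [← integral_const_mul, ← integral_neg]
    refine integral_congr_ae (hu.mono fun x hx => ?_)
    simp only [hx, star_primitiveFrom, smul_eq_mul]
    ring
  simp only [Complex.conjLIE_apply] at hparts
  rw [hleft, ← star_primitiveFrom] at hparts
  simp only [smul_eq_mul, trig_apply_zero] at hparts
  simp only [mul_comm (starRingEnd ℂ (u' _))]
  linear_combination hparts

end Trig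

/-! ### Eigenfunctions are trigonometric -/

namespace QuantumGraph

section TrigSolution

variable {Γ : QuantumGraph} {κ : ℝ} {c d : Γ.V → ℂ} {b : Γ.E → ℂ} {f f' g g' : Γ.L2}

lemma inner_contToL2_right (g : Γ.L2) (F : Γ.E → C(ℝ, ℂ)) :
    inner ℂ g (Γ.contToL2 F) =
      ∑ e, ∫ x in Set.Icc 0 (Γ.len e), starRingEnd ℂ (g e x) * F e x := by
  rw [PiLp.inner_apply]
  refine Finset.sum_congr rfl fun e _ => ?_
  rw [L2.inner_def]
  refine integral_congr_ae ?_
  filter_upwards [coeFn_contToL2 F e] with x hx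
  rw [RCLike.inner_apply, hx, mul_comm]

lemma inner_contToL2_left (F : Γ.E → C(ℝ, ℂ)) (g : Γ.L2) :
    inner ℂ (Γ.contToL2 F) g =
      ∑ e, ∫ x in Set.Icc 0 (Γ.len e), starRingEnd ℂ (F e x) * g e x := by
  rw [← inner_conj_symm, inner_contToL2_right, map_sum]
  refine Finset.sum_congr rfl fun e _ => ?_
  rw [← integral_conj]
  simp only [map_mul, RCLike.conj_conj, mul_comm]

lemma isPrimitiveWithValues_contToL2 {F F' : Γ.E → C(ℝ, ℂ)}
    (hF : ∀ e x, HasDerivAt (F e) (F' e x) x) (hsrc : ∀ e, F e 0 = c (Γ.src e))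
    (htgt : ∀ e, F e (Γ.len e) = c (Γ.tgt e)) :
    Γ.IsPrimitiveWithValues (Γ.contToL2 F) (Γ.contToL2 F') c := by
  have hprim : ∀ e, Set.EqOn (primitiveFrom (c (Γ.src e)) (Γ.contToL2 F' e)) (F e)
      (Set.Icc 0 (Γ.len e)) := fun e x hx => by
    rw [primitiveFrom_congr_ae (coeFn_contToL2 F' e) _ hx, primitiveFrom,
      intervalIntegral.integral_eq_sub_of_hasDerivAt (fun y _ => hF e y)
        ((F' e).continuous.intervalIntegrable _ _), hsrc, add_sub_cancel]
  refine fun e => ⟨?_, (hprim e ⟨(Γ.len_pos e).le, le_rfl⟩).trans (htgt e)⟩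
  filter_upwards [coeFn_contToL2 F e, ae_restrict_mem measurableSet_Icc] with x hx hmem
  rw [hx, hprim e hmem]

lemma isH10_contToL2 (hc : ∀ v ∈ Γ.dir, c v = 0) {F F' : Γ.E → C(ℝ, ℂ)}
    (hF : ∀ e x, HasDerivAt (F e) (F' e x) x) (hsrc : ∀ e, F e 0 = c (Γ.src e))
    (htgt : ∀ e, F e (Γ.len e) = c (Γ.tgt e)) : Γ.IsH10 (Γ.contToL2 F) (Γ.contToL2 F') :=
  isH10_iff_exists_isPrimitiveWithValues.2 ⟨c, hc, isPrimitiveWithValues_contToL2 hF hsrc htgt⟩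

variable (Γ) in
open Classical in
/-- The sum of the derivatives, in the directions pointing into the vertex `v` and divided by `κ`,
of the functions `x ↦ c (src e) cos (κ x) + b e sin (κ x)` on the edges. -/
noncomputable def vertexFlux (κ : ℝ) (c : Γ.V → ℂ) (b : Γ.E → ℂ) (v : Γ.V) : ℂ :=
  ∑ e with Γ.tgt e = v, trig κ (b e) (-c (Γ.src e)) (Γ.len e) - ∑ e with Γ.src e = v, b e

variable (Γ) in
/-- Vertex values `c` and edge coefficients `b` such that the functions
`x ↦ c (src e) cos (κ x) + b e sin (κ x)` form a continuous function on the graph that satisfies the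
vertex conditions. -/
structure IsTrigSolution (κ : ℝ) (c : Γ.V → ℂ) (b : Γ.E → ℂ) : Prop where
  eq_zero_of_mem_dir : ∀ v ∈ Γ.dir, c v = 0
  tgt_eq : ∀ e, trig κ (c (Γ.src e)) (b e) (Γ.len e) = c (Γ.tgt e)
  vertexFlux_eq_zero : ∀ v ∉ Γ.dir, Γ.vertexFlux κ c b v = 0

variable (Γ) in
/-- The element of `L²(Γ)` equal to `x ↦ c (src e) cos (κ x) + b e sin (κ x)` on each edge `e`. -/
noncomputable def trigL2 (κ : ℝ) (c : Γ.V → ℂ) (b : Γ.E → ℂ) : Γ.L2 :=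
  Γ.contToL2 fun e => trig κ (c (Γ.src e)) (b e)

variable (Γ) in
/-- The edgewise derivative of `trigL2`. -/
noncomputable def trigDerivL2 (κ : ℝ) (c : Γ.V → ℂ) (b : Γ.E → ℂ) : Γ.L2 :=
  Γ.contToL2 fun e => (κ : ℂ) • trig κ (b e) (-c (Γ.src e))

lemma sum_mul_vertexFlux (d : Γ.V → ℂ) :
    ∑ v, d v * Γ.vertexFlux κ c b v = ∑ e,
      (d (Γ.tgt e) * trig κ (b e) (-c (Γ.src e)) (Γ.len e) - d (Γ.src e) * b e) := by
  classical
  simp only [vertexFlux, mul_sub, Finset.mul_sum, Finset.sum_filter, Finset.sum_sub_distrib]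
  refine (congrArg₂ (· - ·) Finset.sum_comm Finset.sum_comm).trans ?_
  simp only [mul_ite, mul_zero, Finset.sum_ite_eq, Finset.mem_univ, if_true]

/-- Green's identity. -/
lemma IsPrimitiveWithValues.inner_trigDerivL2_sub (h : Γ.IsPrimitiveWithValues g g' d) :
    inner ℂ g' (Γ.trigDerivL2 κ c b) - κ ^ 2 * inner ℂ g (Γ.trigL2 κ c b) =
      κ * ∑ v, starRingEnd ℂ (d v) * Γ.vertexFlux κ c b v := by
  rw [trigDerivL2, trigL2, inner_contToL2_right, inner_contToL2_right, sum_mul_vertexFlux,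
    Finset.mul_sum, Finset.mul_sum, ← Finset.sum_sub_distrib]
  refine Finset.sum_congr rfl fun e _ => ?_
  rw [← (h e).2]
  exact integral_conj_mul_trig (Γ.len_pos e).le κ _ _ (integrableOn_L2Interval (g' e)) (h e).1

lemma exists_isPrimitiveWithValues (d : Γ.V → ℂ) :
    ∃ g g' : Γ.L2, Γ.IsPrimitiveWithValues g g' d := by
  let slope : Γ.E → ℂ := fun e => (d (Γ.tgt e) - d (Γ.src e)) / Γ.len e
  refine ⟨_, _, isPrimitiveWithValues_contToL2
    (F := fun e => ⟨fun x => d (Γ.src e) + x * slope e, by fun_prop⟩)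
    (F' := fun e => ContinuousMap.const ℝ (slope e)) (fun e x => ?_) (fun e => by simp)
    fun e => ?_⟩
  · simpa using ((hasDerivAt_id x).ofReal_comp.mul_const (slope e)).const_add (d (Γ.src e))
  · have hlen : (Γ.len e : ℂ) ≠ 0 := Complex.ofReal_ne_zero.2 (Γ.len_pos e).ne'
    simp [slope, mul_div_cancel₀ _ hlen]

lemma IsTrigSolution.isH10 (h : Γ.IsTrigSolution κ c b) :
    Γ.IsH10 (Γ.trigL2 κ c b) (Γ.trigDerivL2 κ c b) :=
  isH10_contToL2 h.eq_zero_of_mem_dir (fun _ x => hasDerivAt_trig κ _ _ x)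
    (fun _ => trig_apply_zero _ _ _) h.tgt_eq

lemma IsTrigSolution.inner_trigDerivL2 (h : Γ.IsTrigSolution κ c b) (hg : Γ.IsH10 g g') :
    inner ℂ g' (Γ.trigDerivL2 κ c b) = κ ^ 2 * inner ℂ g (Γ.trigL2 κ c b) := by
  obtain ⟨d, hd, hprim⟩ := isH10_iff_exists_isPrimitiveWithValues.1 hg
  rw [← sub_eq_zero, hprim.inner_trigDerivL2_sub]
  refine mul_eq_zero_of_right _ (Finset.sum_eq_zero fun v _ => ?_)
  by_cases hv : v ∈ Γ.dir
  · rw [hd v hv, map_zero, zero_mul]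
  · rw [h.vertexFlux_eq_zero v hv, mul_zero]

lemma IsTrigSolution.isEigenvector (h : Γ.IsTrigSolution κ c b) :
    Γ.IsEigenvector (κ ^ 2) (Γ.trigL2 κ c b) :=
  ⟨Γ.trigDerivL2 κ c b, h.isH10, fun g g' hg => by
    rw [h.inner_trigDerivL2 hg, inner_smul_right, Complex.ofReal_pow]⟩

lemma IsTrigSolution.norm_trigDerivL2_sq (h : Γ.IsTrigSolution κ c b) :
    ‖Γ.trigDerivL2 κ c b‖ ^ 2 = κ ^ 2 * ‖Γ.trigL2 κ c b‖ ^ 2 := by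
  have hinner := h.inner_trigDerivL2 h.isH10
  rw [inner_self_eq_norm_sq_to_K, inner_self_eq_norm_sq_to_K] at hinner
  simp only [Complex.coe_algebraMap] at hinner
  exact_mod_cast hinner

open Classical in
lemma isH10_contToL2_single (e : Γ.E) {F F' : C(ℝ, ℂ)} (hF : ∀ x, HasDerivAt F (F' x) x)
    (hzero : F 0 = 0) (hlen : F (Γ.len e) = 0) :
    Γ.IsH10 (Γ.contToL2 (Pi.single e F)) (Γ.contToL2 (Pi.single e F')) := by
  refine isH10_contToL2 (c := 0) (fun _ _ => rfl) (fun i x => ?_) (fun i => ?_) fun i => ?_ <;>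
    rcases eq_or_ne i e with rfl | hi
  · simpa using hF x
  · simp [Pi.single_eq_of_ne hi]
  · simpa using hzero
  · simp [Pi.single_eq_of_ne hi]
  · simpa using hlen
  · simp [Pi.single_eq_of_ne hi]

open Classical in
lemma inner_contToL2_single (e : Γ.E) (F : C(ℝ, ℂ)) (g : Γ.L2) :
    inner ℂ (Γ.contToL2 (Pi.single e F)) g =
      ∫ x in Set.Icc 0 (Γ.len e), starRingEnd ℂ (F x) * g e x := by
  rw [inner_contToL2_left, Finset.sum_eq_single e (fun i _ hi => by simp [Pi.single_eq_of_ne hi])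
    (by simp), Pi.single_eq_same]

lemma hasWeakDeriv_of_forall_inner_eq {k : ℂ}
    (h : ∀ g g' : Γ.L2, Γ.IsH10 g g' → inner ℂ g' f' = inner ℂ g (k • f)) (e : Γ.E) :
    HasWeakDeriv (Γ.len e) (f' e) fun x => -(k * f e x) := by
  intro φ hφ hcompact hsupp
  have htest : IsTestFunction (Γ.len e) φ := ⟨hφ, hcompact, hsupp⟩
  let F : C(ℝ, ℂ) := ⟨fun x => (φ x : ℂ), Complex.continuous_ofReal.comp hφ.continuous⟩
  let F' : C(ℝ, ℂ) := ⟨fun x => ((deriv φ x : ℝ) : ℂ),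
    Complex.continuous_ofReal.comp (hφ.continuous_deriv (by simp))⟩
  have hF : ∀ x, HasDerivAt F (F' x) x := fun x =>
    ((hφ.differentiable (by simp)) x).hasDerivAt.ofReal_comp
  have htested := h _ _ (isH10_contToL2_single e hF
    (Complex.ofReal_eq_zero.2 (htest.eq_zero fun hx => lt_irrefl _ hx.1))
    (Complex.ofReal_eq_zero.2 (htest.eq_zero fun hx => lt_irrefl _ hx.2)))
  rw [inner_smul_right, inner_contToL2_single, inner_contToL2_single, ← integral_const_mul]
    at htested
  simpa [F, F', integral_neg, mul_left_comm k] using htested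

lemma IsEigenvector.exists_isTrigSolution (hκ : κ ≠ 0) (hf : Γ.IsEigenvector (κ ^ 2) f) :
    ∃ c b, Γ.IsTrigSolution κ c b ∧ f = Γ.trigL2 κ c b := by
  classical
  have hκ' : (κ : ℂ) ≠ 0 := Complex.ofReal_ne_zero.2 hκ
  obtain ⟨f', hf', hweak⟩ := hf
  obtain ⟨c, hc, hprim⟩ := isH10_iff_exists_isPrimitiveWithValues.1 hf'
  rw [Complex.ofReal_pow] at hweak
  choose b hb' hb using fun e => exists_ae_eq_trig_of_hasWeakDeriv hκ (Γ.len_pos e)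
    (integrableOn_L2Interval (f e)) (integrableOn_L2Interval (f' e)) (hprim e).1
    (hasWeakDeriv_of_forall_inner_eq hweak e)
  have hf_eq : f = Γ.trigL2 κ c b := eq_contToL2 fun e => by
    filter_upwards [(hprim e).1, ae_restrict_mem measurableSet_Icc] with x hx hmem
    rw [hx, hb e hmem]
  have hf'_eq : f' = Γ.trigDerivL2 κ c b := eq_contToL2 hb'
  refine ⟨c, b, ⟨hc, fun e => ?_, fun v hv => ?_⟩, hf_eq⟩
  · rw [← hb e ⟨(Γ.len_pos e).le, le_rfl⟩, (hprim e).2]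
  · obtain ⟨g, g', hg⟩ := exists_isPrimitiveWithValues (Γ := Γ) (Pi.single v 1)
    have hgH10 : Γ.IsH10 g g' := isH10_iff_exists_isPrimitiveWithValues.2 ⟨_, fun w hw =>
      Pi.single_eq_of_ne (ne_of_mem_of_not_mem hw hv) _, hg⟩
    have hgreen := hg.inner_trigDerivL2_sub (κ := κ) (c := c) (b := b)
    rw [← hf_eq, ← hf'_eq, hweak g g' hgH10, inner_smul_right, sub_self,
      Finset.sum_eq_single v (fun w _ hw => by simp [Pi.single_eq_of_ne hw]) (by simp)] at hgreen
    simpa [hκ'] using hgreen.symm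

end TrigSolution

end QuantumGraph

/-! ### Simplicity of the lowest eigenvalue -/

section TrigZeros

variable {κ ℓ x y : ℝ} {a b : ℂ}

lemma trig_sub (κ : ℝ) (a b : ℂ) (x y : ℝ) :
    trig κ a b (x - y) = trig κ (trig κ a b x) (-trig κ b (-a) x) y := by
  simp only [trig_apply, mul_sub, Real.cos_sub, Real.sin_sub]
  push_cast
  ring

lemma trig_eq_zero_of_apply_eq_zero (hx : trig κ a b x = 0) (hx' : trig κ b (-a) x = 0) :
    trig κ a b = 0 := by
  ext y
  have hsub := trig_sub κ a b x (x - y)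
  rwa [sub_sub_cancel, hx, hx', neg_zero, trig_zero_zero] at hsub

lemma sin_mul_sub_eq_zero_of_trig_eq_zero (h : trig κ a b ≠ 0) (hx : trig κ a b x = 0)
    (hy : trig κ a b y = 0) : Real.sin (κ * (x - y)) = 0 := by
  have hderiv : trig κ b (-a) x ≠ 0 := fun hx' => h (trig_eq_zero_of_apply_eq_zero hx hx')
  have hsub := trig_sub κ a b x (x - y)
  rw [sub_sub_cancel, hy, hx, trig_apply, zero_mul, zero_add] at hsub
  exact_mod_cast (mul_eq_zero.1 hsub.symm).resolve_left (neg_ne_zero.2 hderiv)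

lemma countable_setOf_trig_eq_zero (hκ : κ ≠ 0) (h : trig κ a b ≠ 0) :
    {x | trig κ a b x = 0}.Countable := by
  rcases Set.eq_empty_or_nonempty {x | trig κ a b x = 0} with hempty | ⟨y, hy⟩
  · exact hempty ▸ Set.countable_empty
  · refine (Set.countable_range fun n : ℤ => y + n * Real.pi / κ).mono fun x hx => ?_
    obtain ⟨n, hn⟩ := Real.sin_eq_zero_iff.1 (sin_mul_sub_eq_zero_of_trig_eq_zero h hx hy)
    exact ⟨n, by simp only [hn]; field_simp; ring⟩

end TrigZeros

lemma abs_deriv_norm_le_of_hasDerivAt {E : Type*} [NormedAddCommGroup E] [NormedSpace ℝ E]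
    {F : ℝ → E} {F' : E} {x : ℝ} (hF : HasDerivAt F F' x) : |deriv (fun y => ‖F y‖) x| ≤ ‖F'‖ := by
  by_cases h : DifferentiableAt ℝ (fun y => ‖F y‖) x
  · refine le_of_tendsto_of_tendsto (hasDerivAt_iff_tendsto_slope.1 h.hasDerivAt).norm
      (hasDerivAt_iff_tendsto_slope.1 hF).norm (Filter.Eventually.of_forall fun y => ?_)
    simp only [slope_def_module, norm_smul]
    exact mul_le_mul_of_nonneg_left (abs_norm_sub_norm_le _ _) (norm_nonneg _)
  · rw [deriv_zero_of_not_differentiableAt h, abs_zero]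
    exact norm_nonneg _

section TrigNorm

variable {κ ℓ : ℝ} {a b : ℂ}

/-- The modulus of `trig κ a b`, as a complex-valued function. -/
noncomputable def trigNorm (κ : ℝ) (a b : ℂ) : C(ℝ, ℂ) where
  toFun := fun x => (‖trig κ a b x‖ : ℝ)
  continuous_toFun := by fun_prop

/-- The derivative of `trigNorm κ a b` outside the zeros of `trig κ a b`. -/
noncomputable def trigNormDeriv (κ : ℝ) (a b : ℂ) (x : ℝ) : ℂ :=
  (deriv (fun y => ‖trig κ a b y‖) x : ℝ)

lemma norm_trigNormDeriv_le (κ : ℝ) (a b : ℂ) (x : ℝ) :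
    ‖trigNormDeriv κ a b x‖ ≤ ‖κ * trig κ b (-a) x‖ := by
  rw [trigNormDeriv, Complex.norm_real]
  exact abs_deriv_norm_le_of_hasDerivAt (hasDerivAt_trig κ a b x)

lemma memLp_trigNormDeriv (κ ℓ : ℝ) (a b : ℂ) :
    MemLp (trigNormDeriv κ a b) 2 (volume.restrict (Set.Icc 0 ℓ)) :=
  (memLp_restrict_Icc_of_continuous (by fun_prop : Continuous fun x => κ * trig κ b (-a) x)).of_le
    (Complex.measurable_ofReal.comp (measurable_deriv _)).aestronglyMeasurable
    (Filter.Eventually.of_forall (norm_trigNormDeriv_le κ a b))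

lemma primitiveFrom_trigNormDeriv (hκ : κ ≠ 0) (a b : ℂ) :
    Set.EqOn (primitiveFrom (‖a‖ : ℂ) (trigNormDeriv κ a b)) (trigNorm κ a b) (Set.Icc 0 ℓ) := by
  intro x hx
  by_cases hzero : trig κ a b = 0
  · obtain rfl : a = 0 := by rw [← trig_apply_zero κ a b, hzero, ContinuousMap.zero_apply]
    simp [primitiveFrom, trigNormDeriv, trigNorm, hzero]
  · have hint : IntegrableOn (trigNormDeriv κ a b) (Set.Icc 0 ℓ) :=
      (memLp_trigNormDeriv κ ℓ a b).integrable (by norm_num)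
    rw [primitiveFrom, integral_eq_of_hasDerivAt_off_countable (trigNorm κ a b)
      (trigNormDeriv κ a b) (countable_setOf_trig_eq_zero hκ hzero)
      (trigNorm κ a b).continuous.continuousOn
      (fun y hy => ((hasDerivAt_trig κ a b y).differentiableAt.norm ℝ hy.2).hasDerivAt.ofReal_comp)
      (hint.mono_set (Set.uIcc_subset_Icc ⟨le_rfl, hx.1.trans hx.2⟩ hx)).intervalIntegrable]
    simp [trigNorm]

end TrigNorm

section NonnegTrig

open scoped ComplexOrder

variable {κ ℓ : ℝ} {a b : ℂ}

lemma nonneg_of_trig_zero_left_nonneg (hκ : 0 < κ) (hℓ : 0 < ℓ)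
    (h : ∀ x ∈ Set.Icc 0 ℓ, 0 ≤ trig κ 0 b x) : 0 ≤ b := by
  set x := min ℓ (1 / κ)
  have hx : 0 < x := lt_min hℓ (by positivity)
  have hsin : 0 < Real.sin (κ * x) := by
    refine Real.sin_pos_of_pos_of_lt_pi (by positivity) ?_
    calc κ * x ≤ κ * (1 / κ) := by gcongr; exact min_le_right _ _
      _ = 1 := mul_one_div_cancel hκ.ne'
      _ < Real.pi := by linarith [Real.pi_gt_three]
  have hprod := mul_nonneg (h x ⟨hx.le, min_le_left _ _⟩)
    (Complex.zero_le_real.2 (inv_nonneg.2 hsin.le))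
  rwa [trig_apply, zero_mul, zero_add, mul_assoc, ← Complex.ofReal_mul, mul_inv_cancel₀ hsin.ne',
    Complex.ofReal_one, mul_one] at hprod

lemma zero_le_neg_trig_of_nonneg_of_apply_eq_zero (hκ : 0 < κ) (hℓ : 0 < ℓ)
    (h : ∀ x ∈ Set.Icc 0 ℓ, 0 ≤ trig κ a b x) (hzero : trig κ a b ℓ = 0) :
    0 ≤ -trig κ b (-a) ℓ :=
  nonneg_of_trig_zero_left_nonneg hκ hℓ fun y hy => by
    have hreflect := h (ℓ - y) ⟨sub_nonneg.2 hy.2, sub_le_self _ hy.1⟩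
    rwa [trig_sub, hzero] at hreflect

end NonnegTrig

namespace QuantumGraph

section Modulus

variable {Γ : QuantumGraph} {κ : ℝ} {c c₁ c₂ : Γ.V → ℂ} {b b₁ b₂ : Γ.E → ℂ} {v : Γ.V} {e : Γ.E}

lemma norm_le_norm_of_ae_norm_le {f g : Γ.L2}
    (h : ∀ e, ∀ᵐ x ∂volume.restrict (Set.Icc 0 (Γ.len e)), ‖f e x‖ ≤ ‖g e x‖) : ‖f‖ ≤ ‖g‖ := by
  rw [← sq_le_sq₀ (norm_nonneg _) (norm_nonneg _), PiLp.norm_sq_eq_of_L2, PiLp.norm_sq_eq_of_L2]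
  gcongr with e
  exact Lp.norm_le_norm_of_ae_le (h e)

variable (Γ) in
/-- The modulus of `trigL2`. -/
noncomputable def trigNormL2 (κ : ℝ) (c : Γ.V → ℂ) (b : Γ.E → ℂ) : Γ.L2 :=
  Γ.contToL2 fun e => trigNorm κ (c (Γ.src e)) (b e)

variable (Γ) in
/-- The edgewise derivative of `trigNormL2`. -/
noncomputable def trigNormDerivL2 (κ : ℝ) (c : Γ.V → ℂ) (b : Γ.E → ℂ) : Γ.L2 :=
  WithLp.toLp 2 fun e => MemLp.toLp _ (memLp_trigNormDeriv κ (Γ.len e) (c (Γ.src e)) (b e))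

lemma coeFn_trigNormDerivL2 (κ : ℝ) (c : Γ.V → ℂ) (b : Γ.E → ℂ) (e : Γ.E) :
    Γ.trigNormDerivL2 κ c b e =ᵐ[volume.restrict (Set.Icc 0 (Γ.len e))]
      trigNormDeriv κ (c (Γ.src e)) (b e) :=
  MemLp.coeFn_toLp (memLp_trigNormDeriv κ (Γ.len e) (c (Γ.src e)) (b e))

lemma norm_trigL2_le_norm_trigNormL2 (κ : ℝ) (c : Γ.V → ℂ) (b : Γ.E → ℂ) :
    ‖Γ.trigL2 κ c b‖ ≤ ‖Γ.trigNormL2 κ c b‖ :=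
  norm_le_norm_of_ae_norm_le fun e => by
    filter_upwards [coeFn_contToL2 (fun e => trig κ (c (Γ.src e)) (b e)) e,
      coeFn_contToL2 (fun e => trigNorm κ (c (Γ.src e)) (b e)) e] with x htrig hnorm
    rw [trigL2, trigNormL2, htrig, hnorm]
    simp [trigNorm]

lemma norm_trigNormDerivL2_le (κ : ℝ) (c : Γ.V → ℂ) (b : Γ.E → ℂ) :
    ‖Γ.trigNormDerivL2 κ c b‖ ≤ ‖Γ.trigDerivL2 κ c b‖ :=
  norm_le_norm_of_ae_norm_le fun e => by
    filter_upwards [coeFn_trigNormDerivL2 κ c b e,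
      coeFn_contToL2 (fun e => (κ : ℂ) • trig κ (b e) (-c (Γ.src e))) e] with x hnorm htrig
    rw [hnorm, trigDerivL2, htrig]
    exact norm_trigNormDeriv_le κ _ _ x

lemma IsTrigSolution.isH10_trigNormL2 (h : Γ.IsTrigSolution κ c b) (hκ : κ ≠ 0) :
    Γ.IsH10 (Γ.trigNormL2 κ c b) (Γ.trigNormDerivL2 κ c b) := by
  have hprim : ∀ e, Set.EqOn (primitiveFrom (‖c (Γ.src e)‖ : ℂ) (Γ.trigNormDerivL2 κ c b e))
      (trigNorm κ (c (Γ.src e)) (b e)) (Set.Icc 0 (Γ.len e)) := fun e =>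
    (primitiveFrom_congr_ae (coeFn_trigNormDerivL2 κ c b e) _).trans
      (primitiveFrom_trigNormDeriv hκ _ _)
  refine isH10_iff_exists_isPrimitiveWithValues.2 ⟨fun v => (‖c v‖ : ℂ),
    fun v hv => by simp [h.eq_zero_of_mem_dir v hv], fun e => ⟨?_, ?_⟩⟩
  · filter_upwards [coeFn_contToL2 (fun e => trigNorm κ (c (Γ.src e)) (b e)) e,
      ae_restrict_mem measurableSet_Icc] with x hx hmem
    rw [trigNormL2, hx, hprim e hmem]
  · rw [hprim e ⟨(Γ.len_pos e).le, le_rfl⟩]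
    exact congrArg (fun z : ℂ => ((‖z‖ : ℝ) : ℂ)) (h.tgt_eq e)

lemma eqOn_of_contToL2_eq {F G : Γ.E → C(ℝ, ℂ)} (h : Γ.contToL2 F = Γ.contToL2 G) (e : Γ.E) :
    Set.EqOn (F e) (G e) (Set.Icc 0 (Γ.len e)) := fun x hx => by
  rw [← sub_eq_zero, ← map_sub] at h
  exact sub_eq_zero.1 (contToL2_eq_zero_iff.1 h e x hx)

lemma IsTrigSolution.exists_eqOn_trigNorm (h : Γ.IsTrigSolution κ c b) (hc : Γ.IsConnected)
    (hd : Γ.dir.Nonempty) (hκ : κ ≠ 0) (hpoincare : Γ.PoincareInequality (κ ^ 2)) :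
    ∃ c' b', Γ.IsTrigSolution κ c' b' ∧ ∀ e, Set.EqOn (trigNorm κ (c (Γ.src e)) (b e))
      (trig κ (c' (Γ.src e)) (b' e)) (Set.Icc 0 (Γ.len e)) := by
  have hmin : ‖Γ.trigNormDerivL2 κ c b‖ ^ 2 ≤ κ ^ 2 * ‖Γ.trigNormL2 κ c b‖ ^ 2 := by
    calc ‖Γ.trigNormDerivL2 κ c b‖ ^ 2 ≤ ‖Γ.trigDerivL2 κ c b‖ ^ 2 := by
          gcongr
          exact norm_trigNormDerivL2_le κ c b
      _ = κ ^ 2 * ‖Γ.trigL2 κ c b‖ ^ 2 := h.norm_trigDerivL2_sq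
      _ ≤ κ ^ 2 * ‖Γ.trigNormL2 κ c b‖ ^ 2 := by
          gcongr
          exact norm_trigL2_le_norm_trigNormL2 κ c b
  obtain ⟨c', b', h', heq⟩ := (hpoincare.isEigenvector_of_norm_sq_le hc hd
    (h.isH10_trigNormL2 hκ) hmin).exists_isTrigSolution hκ
  exact ⟨c', b', h', eqOn_of_contToL2_eq heq⟩

lemma Incident.exists_trig_eq (he : Γ.Incident e v) : ∃ x ∈ Set.Icc 0 (Γ.len e),
    ∀ {κ : ℝ} {c : Γ.V → ℂ} {b : Γ.E → ℂ}, Γ.IsTrigSolution κ c b →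
      trig κ (c (Γ.src e)) (b e) x = c v := by
  rcases he with rfl | rfl
  · exact ⟨0, ⟨le_rfl, (Γ.len_pos e).le⟩, fun _ => trig_apply_zero _ _ _⟩
  · exact ⟨_, ⟨(Γ.len_pos e).le, le_rfl⟩, fun h => h.tgt_eq e⟩

open scoped ComplexOrder Classical in
/-- All terms of the Kirchhoff condition at `v` have the same sign, so they all vanish. -/
lemma IsTrigSolution.trig_eq_zero_of_nonneg (h : Γ.IsTrigSolution κ c b) (hκ : 0 < κ)
    (hnonneg : ∀ e, ∀ x ∈ Set.Icc 0 (Γ.len e), 0 ≤ trig κ (c (Γ.src e)) (b e) x) (hv : v ∉ Γ.dir)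
    (hcv : c v = 0) (he : Γ.Incident e v) : trig κ (c (Γ.src e)) (b e) = 0 := by
  have hsrc : ∀ e ∈ Finset.univ.filter (Γ.src · = v), 0 ≤ b e := fun e he =>
    nonneg_of_trig_zero_left_nonneg hκ (Γ.len_pos e) fun x hx => by
      simpa only [(Finset.mem_filter.1 he).2, hcv] using hnonneg e x hx
  have htgt_zero : ∀ e, Γ.tgt e = v → trig κ (c (Γ.src e)) (b e) (Γ.len e) = 0 := fun e he => by
    rw [h.tgt_eq, he, hcv]
  have htgt : ∀ e ∈ Finset.univ.filter (Γ.tgt · = v),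
      0 ≤ -trig κ (b e) (-c (Γ.src e)) (Γ.len e) := fun e he =>
    zero_le_neg_trig_of_nonneg_of_apply_eq_zero hκ (Γ.len_pos e) (hnonneg e)
      (htgt_zero e (Finset.mem_filter.1 he).2)
  have hflux : ∑ e with Γ.tgt e = v, -trig κ (b e) (-c (Γ.src e)) (Γ.len e) +
      ∑ e with Γ.src e = v, b e = 0 := by
    rw [Finset.sum_neg_distrib, ← neg_eq_zero, neg_add, neg_neg, ← sub_eq_add_neg]
    exact h.vertexFlux_eq_zero v hv
  obtain ⟨htgt_sum, hsrc_sum⟩ :=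
    (add_eq_zero_iff_of_nonneg (Finset.sum_nonneg htgt) (Finset.sum_nonneg hsrc)).1 hflux
  rcases he with he | he
  · rw [he, hcv, (Finset.sum_eq_zero_iff_of_nonneg hsrc).1 hsrc_sum e (by simpa using he),
      trig_zero_zero]
  · exact trig_eq_zero_of_apply_eq_zero (htgt_zero e he) (neg_eq_zero.1
      ((Finset.sum_eq_zero_iff_of_nonneg htgt).1 htgt_sum e (by simpa using he)))

lemma IsTrigSolution.trig_eq_zero_of_incident (h : Γ.IsTrigSolution κ c b) (hc : Γ.IsConnected)
    (hd : Γ.dir.Nonempty) (hκ : 0 < κ) (hpoincare : Γ.PoincareInequality (κ ^ 2)) (hv : v ∉ Γ.dir)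
    (hcv : c v = 0) (he : Γ.Incident e v) :
    ∀ x ∈ Set.Icc 0 (Γ.len e), trig κ (c (Γ.src e)) (b e) x = 0 := by
  open scoped ComplexOrder in
  obtain ⟨c', b', h', heq⟩ := h.exists_eqOn_trigNorm hc hd hκ.ne' hpoincare
  have hcv' : c' v = 0 := by
    obtain ⟨x, hx, htrig⟩ := he.exists_trig_eq
    rw [← htrig h', ← heq e hx]
    simp [trigNorm, htrig h, hcv]
  have hnonneg : ∀ e, ∀ x ∈ Set.Icc 0 (Γ.len e), 0 ≤ trig κ (c' (Γ.src e)) (b' e) x :=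
    fun e x hx => heq e hx ▸ Complex.zero_le_real.2 (norm_nonneg _)
  intro x hx
  have hnorm := heq e hx
  rw [h'.trig_eq_zero_of_nonneg hκ hnonneg hv hcv' he] at hnorm
  simpa [trigNorm] using hnorm

lemma IsTrigSolution.trigL2_eq_zero_of_edge (h : Γ.IsTrigSolution κ c b) (hc : Γ.IsConnected)
    (hd : Γ.dir.Nonempty) (hκ : 0 < κ) (hpoincare : Γ.PoincareInequality (κ ^ 2))
    (heff : ¬ Γ.IsEffectivelyDisconnected) {e₀ : Γ.E}
    (he₀ : ∀ x ∈ Set.Icc 0 (Γ.len e₀), trig κ (c (Γ.src e₀)) (b e₀) x = 0) :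
    Γ.trigL2 κ c b = 0 := by
  have hpropagate : ∀ e e' v, v ∉ Γ.dir → Γ.Incident e v → Γ.Incident e' v →
      (∀ x ∈ Set.Icc 0 (Γ.len e), trig κ (c (Γ.src e)) (b e) x = 0) →
      ∀ x ∈ Set.Icc 0 (Γ.len e'), trig κ (c (Γ.src e')) (b e') x = 0 := by
    intro e e' v hv he he' hzero
    obtain ⟨x, hx, htrig⟩ := he.exists_trig_eq
    exact h.trig_eq_zero_of_incident hc hd hκ hpoincare hv (htrig h ▸ hzero x hx) he'
  rw [trigL2, contToL2_eq_zero_iff]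
  intro e
  obtain ⟨p⟩ := not_not.1 heff e₀ e
  induction p with
  | nil => exact he₀
  | cons hadj _ ih =>
    obtain ⟨-, ⟨v, hv, he, he'⟩ | ⟨v, hv, he', he⟩⟩ := (SimpleGraph.fromRel_adj _ _ _).1 hadj
    all_goals exact ih (hpropagate _ _ v hv he he' he₀)

lemma IsTrigSolution.linearCombination (h₁ : Γ.IsTrigSolution κ c₁ b₁)
    (h₂ : Γ.IsTrigSolution κ c₂ b₂) (s t : ℂ) :
    Γ.IsTrigSolution κ (s • c₁ + t • c₂) (s • b₁ + t • b₂) := by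
  refine ⟨fun v hv => ?_, fun e => ?_, fun v hv => ?_⟩
  · simp [h₁.eq_zero_of_mem_dir v hv, h₂.eq_zero_of_mem_dir v hv]
  · have htgt₁ := h₁.tgt_eq e
    have htgt₂ := h₂.tgt_eq e
    simp only [trig_apply, Pi.add_apply, Pi.smul_apply, smul_eq_mul] at htgt₁ htgt₂ ⊢
    linear_combination s * htgt₁ + t * htgt₂
  · have hflux : Γ.vertexFlux κ (s • c₁ + t • c₂) (s • b₁ + t • b₂) v =
        s * Γ.vertexFlux κ c₁ b₁ v + t * Γ.vertexFlux κ c₂ b₂ v := by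
      simp only [vertexFlux, mul_sub, Finset.mul_sum]
      rw [sub_add_sub_comm, ← Finset.sum_add_distrib, ← Finset.sum_add_distrib]
      refine congrArg₂ _ (Finset.sum_congr rfl fun e _ => ?_) rfl
      simp only [trig_apply, Pi.add_apply, Pi.smul_apply, smul_eq_mul]
      ring
    rw [hflux, h₁.vertexFlux_eq_zero v hv, h₂.vertexFlux_eq_zero v hv, mul_zero, mul_zero, add_zero]

lemma trigL2_linearCombination (κ : ℝ) (c₁ c₂ : Γ.V → ℂ) (b₁ b₂ : Γ.E → ℂ) (s t : ℂ) :
    Γ.trigL2 κ (s • c₁ + t • c₂) (s • b₁ + t • b₂) =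
      s • Γ.trigL2 κ c₁ b₁ + t • Γ.trigL2 κ c₂ b₂ := by
  rw [trigL2, trigL2, trigL2, ← map_smul, ← map_smul, ← map_add]
  congr 1
  ext e x
  simp only [trig_apply, Pi.add_apply, Pi.smul_apply, smul_eq_mul, ContinuousMap.add_apply,
    ContinuousMap.smul_apply]
  ring

lemma IsTrigSolution.trigL2_eq_zero_of_src (h : Γ.IsTrigSolution κ c b) (hc : Γ.IsConnected)
    (hd : Γ.dir.Nonempty) (hκ : 0 < κ) (hpoincare : Γ.PoincareInequality (κ ^ 2))
    (heff : ¬ Γ.IsEffectivelyDisconnected) (hce : c (Γ.src e) = 0)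
    (hbe : Γ.src e ∈ Γ.dir → b e = 0) : Γ.trigL2 κ c b = 0 := by
  refine h.trigL2_eq_zero_of_edge hc hd hκ hpoincare heff (e₀ := e) ?_
  by_cases hsrc : Γ.src e ∈ Γ.dir
  · simp [hce, hbe hsrc]
  · exact h.trig_eq_zero_of_incident hc hd hκ hpoincare hsrc hce (Or.inl rfl)

end Modulus

lemma exists_smul_add_smul_eq_zero (z₁ z₂ : ℂ) :
    ∃ s t : ℂ, s * z₁ + t * z₂ = 0 ∧ ¬ (s = 0 ∧ t = 0) := by
  by_cases h : z₁ = 0 ∧ z₂ = 0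
  · exact ⟨1, 0, by simp [h.1], by simp⟩
  · exact ⟨z₂, -z₁, by ring, fun hst => h ⟨neg_eq_zero.1 hst.2, hst.1⟩⟩

lemma eq_zero_and_eq_zero_of_linearIndependent {K M ι : Type*} [Ring K] [AddCommGroup M]
    [Module K M] {f : ι → M} (hf : LinearIndependent K f) {i j : ι} (hij : i ≠ j) {s t : K}
    (h : s • f i + t • f j = 0) : s = 0 ∧ t = 0 := by
  have hpair := hf.comp ![i, j]
    (by simpa [Function.Injective, Fin.forall_fin_two] using ⟨hij, hij.symm⟩)
  exact LinearIndependent.pair_iff.1 (by convert hpair using 1; ext x; fin_cases x <;> rfl) s t h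

theorem isEffectivelyDisconnected_of_ratio_eq_one {Γ : QuantumGraph} (hc : Γ.IsConnected)
    (hd : Γ.dir.Nonempty) {k : ℕ} (hk : 2 ≤ k) (h : Γ.ratio k 1 = 1) :
    Γ.IsEffectivelyDisconnected := by
  by_contra heff
  obtain ⟨m, hm, hpoincare, f, hf, heig⟩ :=
    exists_linearIndependent_isEigenvector_of_ratio_eq_one hc hd h
  obtain ⟨κ, hκ, rfl⟩ : ∃ κ : ℝ, 0 < κ ∧ κ ^ 2 = m := ⟨√m, Real.sqrt_pos.2 hm, Real.sq_sqrt hm.le⟩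
  obtain ⟨c₁, b₁, h₁, hf₁⟩ := (heig ⟨0, by omega⟩).exists_isTrigSolution hκ.ne'
  obtain ⟨c₂, b₂, h₂, hf₂⟩ := (heig ⟨1, by omega⟩).exists_isTrigSolution hκ.ne'
  let e : Γ.E := Classical.arbitrary Γ.E
  obtain ⟨s, t, hne, hce, hbe⟩ : ∃ s t : ℂ, ¬ (s = 0 ∧ t = 0) ∧
      (s • c₁ + t • c₂) (Γ.src e) = 0 ∧ (Γ.src e ∈ Γ.dir → (s • b₁ + t • b₂) e = 0) := by
    by_cases hsrc : Γ.src e ∈ Γ.dir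
    · obtain ⟨s, t, hst, hne⟩ := exists_smul_add_smul_eq_zero (b₁ e) (b₂ e)
      exact ⟨s, t, hne, (h₁.linearCombination h₂ s t).eq_zero_of_mem_dir _ hsrc, fun _ => hst⟩
    · obtain ⟨s, t, hst, hne⟩ := exists_smul_add_smul_eq_zero (c₁ (Γ.src e)) (c₂ (Γ.src e))
      exact ⟨s, t, hne, hst, fun hmem => absurd hmem hsrc⟩
  have hzero := (h₁.linearCombination h₂ s t).trigL2_eq_zero_of_src hc hd hκ hpoincare heff hce hbe
  rw [trigL2_linearCombination, ← hf₁, ← hf₂] at hzero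
  exact hne (eq_zero_and_eq_zero_of_linearIndependent hf (by simp) hzero)

end QuantumGraph

/-! ### Combinatorics of trees -/

namespace QuantumGraph

section Combinatorics

variable {Γ : QuantumGraph} {e e' : Γ.E} {v w : Γ.V}

variable (Γ) in
/-- The simple graph on the vertices whose connectedness is `IsConnected`. -/
def vertexGraph : SimpleGraph Γ.V :=
  SimpleGraph.fromRel fun v w => ∃ e, Γ.src e = v ∧ Γ.tgt e = w

variable (Γ) in
/-- The simple graph on the edges joining two edges that meet at a non-Dirichlet vertex; `Γ` is
effectively disconnected if it is not connected. -/
def edgeGraph : SimpleGraph Γ.E :=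
  SimpleGraph.fromRel fun e e' => ∃ v, v ∉ Γ.dir ∧ Γ.Incident e v ∧ Γ.Incident e' v

lemma exists_incident_of_vertexGraph_adj (h : Γ.vertexGraph.Adj v w) :
    ∃ e, Γ.Incident e v ∧ Γ.Incident e w := by
  obtain ⟨-, ⟨e, hsrc, htgt⟩ | ⟨e, hsrc, htgt⟩⟩ := (SimpleGraph.fromRel_adj _ _ _).1 h
  · exact ⟨e, Or.inl hsrc, Or.inr htgt⟩
  · exact ⟨e, Or.inr htgt, Or.inl hsrc⟩

variable (Γ) in
/-- The ends of edges glued to the vertex `v`, a loop at `v` contributing two of them. -/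
abbrev EdgeEnd (v : Γ.V) : Type := {e // Γ.src e = v} ⊕ {e // Γ.tgt e = v}

lemma degree_eq_card_edgeEnd (v : Γ.V) : Γ.degree v = Nat.card (Γ.EdgeEnd v) :=
  Nat.card_sum.symm

lemma Incident.exists_edgeEnd (h : Γ.Incident e v) :
    ∃ x : Γ.EdgeEnd v, Sum.elim Subtype.val Subtype.val x = e :=
  h.elim (fun h => ⟨Sum.inl ⟨e, h⟩, rfl⟩) fun h => ⟨Sum.inr ⟨e, h⟩, rfl⟩

lemma degree_pos_of_incident (h : Γ.Incident e v) : 0 < Γ.degree v := by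
  obtain ⟨x, -⟩ := h.exists_edgeEnd
  exact degree_eq_card_edgeEnd v ▸ Nat.card_pos_iff.2 ⟨⟨x⟩, inferInstance⟩

lemma two_le_degree_of_incident (hne : e ≠ e') (h : Γ.Incident e v) (h' : Γ.Incident e' v) :
    2 ≤ Γ.degree v := by
  obtain ⟨x, rfl⟩ := h.exists_edgeEnd
  obtain ⟨x', rfl⟩ := h'.exists_edgeEnd
  have : Nontrivial (Γ.EdgeEnd v) := ⟨x, x', ne_of_apply_ne _ hne⟩
  exact degree_eq_card_edgeEnd v ▸ Finite.one_lt_card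

lemma sum_natCard_fiber {α β : Type*} [Finite α] [Fintype β] (f : α → β) :
    ∑ b, Nat.card {a // f a = b} = Nat.card α := by
  rw [← Nat.card_sigma, Nat.card_congr (Equiv.sigmaFiberEquiv f)]

lemma sum_degree : ∑ v, Γ.degree v = 2 * Fintype.card Γ.E := by
  simp only [degree, Finset.sum_add_distrib, sum_natCard_fiber, Nat.card_eq_fintype_card, two_mul]

lemma IsConnected.degree_pos (hc : Γ.IsConnected) (v : Γ.V) : 0 < Γ.degree v := by
  obtain ⟨p⟩ := hc.preconnected v (Γ.src (Classical.arbitrary Γ.E))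
  cases p with
  | nil => exact degree_pos_of_incident (Or.inl rfl)
  | cons hadj p =>
    obtain ⟨e, he, -⟩ := exists_incident_of_vertexGraph_adj hadj
    exact degree_pos_of_incident he

lemma IsTree.exists_isLeaf (h : Γ.IsTree) : ∃ v, Γ.IsLeaf v := by
  by_contra! hleaf
  have hdegree : ∀ v, 2 ≤ Γ.degree v := fun v =>
    Nat.lt_of_le_of_ne (h.1.degree_pos v) fun hv => hleaf v hv.symm
  have hsum : ∑ _v : Γ.V, 2 ≤ ∑ v, Γ.degree v := Finset.sum_le_sum fun v _ => hdegree v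
  have hbetti := h.2
  rw [sum_degree, Finset.sum_const, Finset.card_univ, smul_eq_mul] at hsum
  rw [betti] at hbetti
  omega

lemma IsWideDirichletTree.dir_nonempty (h : Γ.IsWideDirichletTree) : Γ.dir.Nonempty := by
  obtain ⟨v, hv⟩ := h.1.exists_isLeaf
  exact ⟨v, h.2 v hv⟩

lemma IsDirichletTree.isWideDirichletTree (h : Γ.IsDirichletTree) : Γ.IsWideDirichletTree :=
  ⟨h.1, fun v => (h.2 v).2⟩

lemma reachable_edgeGraph_of_incident (hdir : ¬ Γ.HasInteriorDirichletVertex)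
    (he : Γ.Incident e v) (he' : Γ.Incident e' v) : Γ.edgeGraph.Reachable e e' := by
  rcases eq_or_ne e e' with rfl | hne
  · exact SimpleGraph.Reachable.refl e
  · have hv : v ∉ Γ.dir := fun hv => hdir ⟨v, hv, two_le_degree_of_incident hne he he'⟩
    exact ((SimpleGraph.fromRel_adj _ _ _).2 ⟨hne, Or.inl ⟨v, hv, he, he'⟩⟩).reachable

lemma reachable_edgeGraph_of_walk (hdir : ¬ Γ.HasInteriorDirichletVertex)
    (p : Γ.vertexGraph.Walk v w) (he : Γ.Incident e v) (he' : Γ.Incident e' w) :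
    Γ.edgeGraph.Reachable e e' := by
  induction p generalizing e with
  | nil => exact reachable_edgeGraph_of_incident hdir he he'
  | cons hadj _ ih =>
    obtain ⟨e₁, hv, hu⟩ := exists_incident_of_vertexGraph_adj hadj
    exact (reachable_edgeGraph_of_incident hdir he hv).trans (ih hu he')

lemma IsEffectivelyDisconnected.hasInteriorDirichletVertex (h : Γ.IsEffectivelyDisconnected)
    (hc : Γ.IsConnected) : Γ.HasInteriorDirichletVertex := by
  by_contra hdir
  refine h fun e e' => ?_
  obtain ⟨p⟩ := hc.preconnected (Γ.src e) (Γ.src e')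
  exact reachable_edgeGraph_of_walk hdir p (Or.inl rfl) (Or.inl rfl)

end Combinatorics

end QuantumGraph

/-! ### Star graphs -/

lemma cot_eq_tan (x : ℝ) : Real.cot x = Real.tan (Real.pi / 2 - x) := by
  rw [Real.tan_pi_div_two_sub, Real.cot_eq_cos_div_sin, Real.tan_eq_sin_div_cos, inv_div]

lemma strictAntiOn_cot : StrictAntiOn Real.cot (Set.Ioo 0 Real.pi) := fun x hx y hy hxy => by
  rw [cot_eq_tan, cot_eq_tan]
  exact Real.strictMonoOn_tan ⟨by linarith [hy.2], by linarith [hy.1]⟩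
    ⟨by linarith [hx.2], by linarith [hx.1]⟩ (by linarith)

namespace QuantumGraph

/-- The star with centre `none`, whose edge `i`, of length `len i`, joins the centre to the leaf
`some i`. -/
abbrev starGraph (ι : Type) [Fintype ι] [Nonempty ι] (len : ι → ℝ) (hlen : ∀ i, 0 < len i)
    (D : Set (Option ι)) : QuantumGraph where
  V := Option ι
  E := ι
  src := fun _ => none
  tgt := some
  len := len
  len_pos := hlen
  dir := D

lemma some_mem_compl_none {ι : Type*} (i : ι) : some i ∈ ({none}ᶜ : Set (Option ι)) := by simp

section StarGraph

variable {ι : Type} [Fintype ι] [Nonempty ι] {len : ι → ℝ} {hlen : ∀ i, 0 < len i}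
  {D : Set (Option ι)} {κ : ℝ} {c : Option ι → ℂ} {b : ι → ℂ}

lemma starGraph_isConnected : (starGraph ι len hlen D).IsConnected := by
  have hreach : ∀ v, (starGraph ι len hlen D).vertexGraph.Reachable none v := fun v => by
    rcases v with _ | i
    · exact SimpleGraph.Reachable.refl _
    · exact ((SimpleGraph.fromRel_adj _ _ _).2 ⟨by simp, Or.inl ⟨i, rfl, rfl⟩⟩).reachable
  exact ⟨fun v w => (hreach v).symm.trans (hreach w)⟩

lemma starGraph_isTree : (starGraph ι len hlen D).IsTree :=
  ⟨starGraph_isConnected, by simp [betti]⟩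

lemma starGraph_degree_some (i : ι) : (starGraph ι len hlen D).degree (some i) = 1 := by
  simp [degree]

lemma starGraph_degree_none : (starGraph ι len hlen D).degree none = Fintype.card ι := by
  simp [degree]

lemma starGraph_isDirichletTree (hcard : 2 ≤ Fintype.card ι) :
    (starGraph ι len hlen {none}ᶜ).IsDirichletTree := by
  refine ⟨starGraph_isTree, fun v => ?_⟩
  rcases v with _ | i
  · simpa [IsLeaf, starGraph_degree_none] using (by omega : Fintype.card ι ≠ 1)
  · simp [IsLeaf, starGraph_degree_some]

lemma starGraph_vertexFlux_none :
    (starGraph ι len hlen D).vertexFlux κ c b none = -∑ i, b i := by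
  simp [vertexFlux]

section DirichletLeaves

variable (hD : ∀ i, some i ∈ D)
include hD

lemma starGraph_dir_nonempty : (starGraph ι len hlen D).dir.Nonempty :=
  ⟨_, hD (Classical.arbitrary ι)⟩

lemma starGraph_isTrigSolution_zero (hb : ∀ i, b i * Real.sin (κ * len i) = 0)
    (hsum : none ∉ D → ∑ i, b i = 0) : (starGraph ι len hlen D).IsTrigSolution κ 0 b where
  eq_zero_of_mem_dir _ _ := rfl
  tgt_eq i := by simpa [trig_apply] using hb i
  vertexFlux_eq_zero v hv := by
    rcases v with _ | i
    · rw [starGraph_vertexFlux_none, hsum hv, neg_zero]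
    · exact absurd (hD i) hv

lemma starGraph_eq_neg_mul_cot (hκ : 0 < κ) (hlt : ∀ i, κ * len i < Real.pi)
    (h : (starGraph ι len hlen D).IsTrigSolution κ c b) (i : ι) :
    b i = -(c none * (Real.cot (κ * len i) : ℝ)) := by
  have htgt : trig κ (c none) (b i) (len i) = 0 :=
    (h.tgt_eq i).trans (h.eq_zero_of_mem_dir _ (hD i))
  have hsin : ((Real.sin (κ * len i) : ℝ) : ℂ) ≠ 0 :=
    Complex.ofReal_ne_zero.2 (Real.sin_pos_of_pos_of_lt_pi (mul_pos hκ (hlen i)) (hlt i)).ne'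
  rw [trig_apply] at htgt
  rw [Real.cot_eq_cos_div_sin, Complex.ofReal_div]
  field_simp
  linear_combination htgt

lemma starGraph_trigL2_eq_zero (hκ : 0 < κ) (hlt : ∀ i, κ * len i < Real.pi)
    (h : (starGraph ι len hlen D).IsTrigSolution κ c b) (hc : c none = 0) :
    (starGraph ι len hlen D).trigL2 κ c b = 0 := by
  refine contToL2_eq_zero_iff.2 fun i x _ => ?_
  rw [hc, starGraph_eq_neg_mul_cot hD hκ hlt h i, hc, zero_mul, neg_zero, trig_zero_zero,
    ContinuousMap.zero_apply]

lemma starGraph_sum_cot_eq_zero (hnone : none ∉ D) (hκ : 0 < κ)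
    (hlt : ∀ i, κ * len i < Real.pi) (h : (starGraph ι len hlen D).IsTrigSolution κ c b)
    (hne : (starGraph ι len hlen D).trigL2 κ c b ≠ 0) : ∑ i, Real.cot (κ * len i) = 0 := by
  have hflux := h.vertexFlux_eq_zero none hnone
  simp only [starGraph_vertexFlux_none, starGraph_eq_neg_mul_cot hD hκ hlt h,
    Finset.sum_neg_distrib, neg_neg, ← Finset.mul_sum] at hflux
  exact_mod_cast (mul_eq_zero.1 hflux).resolve_left
    (mt (starGraph_trigL2_eq_zero hD hκ hlt h) hne)

lemma starGraph_exists_isTrigSolution {μ : ℝ} {f : (starGraph ι len hlen D).L2} (hf : f ≠ 0)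
    (h : (starGraph ι len hlen D).IsEigenvector μ f) :
    ∃ κ > 0, κ ^ 2 = μ ∧ ∃ c b, (starGraph ι len hlen D).IsTrigSolution κ c b ∧
      f = (starGraph ι len hlen D).trigL2 κ c b := by
  have hμ := h.pos starGraph_isConnected (starGraph_dir_nonempty hD) hf
  rw [← Real.sq_sqrt hμ.le] at h
  exact ⟨√μ, Real.sqrt_pos.2 hμ, Real.sq_sqrt hμ.le,
    h.exists_isTrigSolution (Real.sqrt_pos.2 hμ).ne'⟩

/-- The secular equation `∑ cot (κ len i) = 0` has no solution below `κ`. -/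
lemma starGraph_sq_le_eigenvalue (hnone : none ∉ D) (hκ : 0 < κ)
    (hlt : ∀ i, κ * len i < Real.pi) (hcot : 0 ≤ ∑ i, Real.cot (κ * len i)) {j : ℕ} (hj : 1 ≤ j) :
    κ ^ 2 ≤ (starGraph ι len hlen D).eigenvalue j := by
  refine le_eigenvalue_of_forall_isEigenvector starGraph_isConnected (starGraph_dir_nonempty hD)
    hj fun μ f hf hμ => ?_
  obtain ⟨κ', hκ', rfl, c, b, h, rfl⟩ := starGraph_exists_isTrigSolution hD hf hμ
  by_contra! hsq
  have hκκ' : κ' < κ := lt_of_pow_lt_pow_left₀ 2 hκ.le hsq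
  have hmul : ∀ i, κ' * len i < κ * len i := fun i => mul_lt_mul_of_pos_right hκκ' (hlen i)
  have hsum : ∑ i, Real.cot (κ * len i) < ∑ i, Real.cot (κ' * len i) :=
    Finset.sum_lt_sum_of_nonempty Finset.univ_nonempty fun i _ => strictAntiOn_cot
      ⟨mul_pos hκ' (hlen i), (hmul i).trans (hlt i)⟩ ⟨mul_pos hκ (hlen i), hlt i⟩ (hmul i)
  exact (hcot.trans_lt hsum).ne'
    (starGraph_sum_cot_eq_zero hD hnone hκ' (fun i => (hmul i).trans (hlt i)) h hf)

end DirichletLeaves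

end StarGraph

lemma linearIndependent_contToL2 {Γ : QuantumGraph} {n : ℕ} {F : Fin n → Γ.E → C(ℝ, ℂ)}
    (h : ∀ g : Fin n → ℂ, (∀ e, ∀ x ∈ Set.Icc 0 (Γ.len e), ∑ i, g i * F i e x = 0) →
      ∀ i, g i = 0) : LinearIndependent ℂ fun i => Γ.contToL2 (F i) := by
  refine Fintype.linearIndependent_iff.2 fun g hg => h g fun e x hx => ?_
  simp_rw [← map_smul, ← map_sum] at hg
  simpa [Finset.sum_apply, ContinuousMap.sum_apply] using contToL2_eq_zero_iff.1 hg e x hx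

section EqualEdges

variable {ι : Type} {n : ℕ} {ℓ : ℝ} {p : Fin (n + 1) → ι}

/-- The coefficients of the function on a star that is `sin (κ x)` on the edge `p i.succ` and
`-sin (κ x)` on the edge `p 0`. -/
def edgeDifference [DecidableEq ι] (p : Fin (n + 1) → ι) (i : Fin n) : ι → ℂ :=
  Pi.single (p i.succ) 1 - Pi.single (p 0) 1

lemma edgeDifference_apply_succ [DecidableEq ι] (hp : p.Injective) (i i' : Fin n) :
    edgeDifference p i (p i'.succ) = if i' = i then 1 else 0 := by
  simp [edgeDifference, Pi.single_apply, hp.eq_iff, Fin.succ_ne_zero]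

lemma sum_mul_trig_edgeDifference [DecidableEq ι] (hℓ : 0 < ℓ) (hp : p.Injective)
    (g : Fin n → ℂ) (i : Fin n) :
    ∑ i', g i' * trig (Real.pi / ℓ) 0 (edgeDifference p i' (p i.succ)) (ℓ / 2) = g i := by
  have harg : Real.pi / ℓ * (ℓ / 2) = Real.pi / 2 := by field_simp
  simp [trig_apply, harg, edgeDifference_apply_succ hp]

variable [Fintype ι] [Nonempty ι] {len : ι → ℝ} {hlen : ∀ i, 0 < len i} {D : Set (Option ι)}

lemma starGraph_isTrigSolution_edgeDifference [DecidableEq ι] (hD : ∀ i, some i ∈ D)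
    (hℓ : 0 < ℓ) (hp : ∀ i, len (p i) = ℓ) (i : Fin n) :
    (starGraph ι len hlen D).IsTrigSolution (Real.pi / ℓ) 0 (edgeDifference p i) := by
  refine starGraph_isTrigSolution_zero hD (fun e => ?_) fun _ => by simp [edgeDifference]
  by_cases he : ∃ i', p i' = e
  · obtain ⟨i', rfl⟩ := he
    rw [hp, div_mul_cancel₀ _ hℓ.ne', Real.sin_pi, Complex.ofReal_zero, mul_zero]
  · rw [edgeDifference, Pi.sub_apply, Pi.single_eq_of_ne fun h => he ⟨_, h.symm⟩,
      Pi.single_eq_of_ne fun h => he ⟨_, h.symm⟩, sub_zero, zero_mul]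

lemma starGraph_eigenvalue_le_of_equal_edges (hD : ∀ i, some i ∈ D) (hℓ : 0 < ℓ)
    (hp : p.Injective) (hlen_eq : ∀ i, len (p i) = ℓ) (hn : 1 ≤ n) :
    (starGraph ι len hlen D).eigenvalue n ≤ (Real.pi / ℓ) ^ 2 := by
  classical
  refine eigenvalue_le starGraph_isConnected (starGraph_dir_nonempty hD) hn
    ⟨fun i => (starGraph ι len hlen D).trigL2 (Real.pi / ℓ) 0 (edgeDifference p i),
      linearIndependent_contToL2 fun g hg i => ?_, fun i => ⟨_, le_rfl,
        (starGraph_isTrigSolution_edgeDifference hD hℓ hlen_eq i).isEigenvector⟩⟩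
  rw [← sum_mul_trig_edgeDifference hℓ hp g i]
  refine hg (p i.succ) (ℓ / 2) ⟨by positivity, ?_⟩
  simp only [hlen_eq]
  linarith

end EqualEdges

section EquilateralStar

variable {k j : ℕ} {ℓ : ℝ} {hℓ : 0 < ℓ}

lemma starGraph_eigenvalue_of_dirichlet_centre [NeZero k] (hj : 1 ≤ j) (hjk : j ≤ k) :
    (starGraph (Fin k) (fun _ => ℓ) (fun _ => hℓ) Set.univ).eigenvalue j = (Real.pi / ℓ) ^ 2 := by
  have hD : ∀ i : Fin k, some i ∈ (Set.univ : Set (Option (Fin k))) := fun _ => Set.mem_univ _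
  refine le_antisymm ?_ ?_
  · refine eigenvalue_le starGraph_isConnected (starGraph_dir_nonempty hD) hj
      (HasEigenvectorsLE.mono ⟨fun i => trigL2 _ (Real.pi / ℓ) 0 (Pi.single i 1),
        linearIndependent_contToL2 fun g hg i => ?_, fun i => ⟨_, le_rfl,
          (starGraph_isTrigSolution_zero hD (fun e => ?_) (by simp)).isEigenvector⟩⟩ hjk)
    · have harg : Real.pi / ℓ * (ℓ / 2) = Real.pi / 2 := by field_simp
      simpa [trig_apply, harg, Pi.single_apply] using
        hg i (ℓ / 2) ⟨by positivity, half_le_self hℓ.le⟩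
    · rw [div_mul_cancel₀ _ hℓ.ne', Real.sin_pi, Complex.ofReal_zero, mul_zero]
  · refine le_eigenvalue_of_forall_isEigenvector starGraph_isConnected (starGraph_dir_nonempty hD)
      hj fun μ f hf hμ => ?_
    obtain ⟨κ, hκ, rfl, c, b, h, rfl⟩ := starGraph_exists_isTrigSolution hD hf hμ
    by_contra! hsq
    have hlt : κ < Real.pi / ℓ := lt_of_pow_lt_pow_left₀ 2 (by positivity) hsq
    exact hf (starGraph_trigL2_eq_zero hD hκ (fun _ => (lt_div_iff₀ hℓ).1 hlt) h
      (h.eq_zero_of_mem_dir _ (Set.mem_univ _)))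

lemma starGraph_isTrigSolution_cos [NeZero k] :
    (starGraph (Fin k) (fun _ => ℓ) (fun _ => hℓ) {none}ᶜ).IsTrigSolution (Real.pi / (2 * ℓ))
      (Pi.single none 1) 0 where
  eq_zero_of_mem_dir _ hv := Pi.single_eq_of_ne hv _
  tgt_eq i := by
    have harg : Real.pi / (2 * ℓ) * ℓ = Real.pi / 2 := by field_simp
    simp [trig_apply, harg]
  vertexFlux_eq_zero v hv := by
    obtain rfl : v = none := not_not.1 hv
    simp [starGraph_vertexFlux_none]

lemma starGraph_hasEigenvectorsLE_of_equal_length (n : ℕ) :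
    (starGraph (Fin (n + 1)) (fun _ => ℓ) (fun _ => hℓ) {none}ᶜ).HasEigenvectorsLE (n + 1)
      ((Real.pi / ℓ) ^ 2) := by
  let κ : Fin (n + 1) → ℝ := Fin.cons (Real.pi / (2 * ℓ)) fun _ => Real.pi / ℓ
  let c : Fin (n + 1) → Option (Fin (n + 1)) → ℂ := Fin.cons (Pi.single none 1) 0
  let b : Fin (n + 1) → Fin (n + 1) → ℂ := Fin.cons 0 (edgeDifference id)
  have htrig : ∀ i, (starGraph (Fin (n + 1)) (fun _ => ℓ) (fun _ => hℓ) {none}ᶜ).IsTrigSolution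
      (κ i) (c i) (b i) := Fin.cases starGraph_isTrigSolution_cos fun i =>
    starGraph_isTrigSolution_edgeDifference some_mem_compl_none hℓ (fun _ => rfl) i
  have hκ : ∀ i, κ i ^ 2 ≤ (Real.pi / ℓ) ^ 2 := Fin.cases
    (pow_le_pow_left₀ (by positivity)
      (div_le_div_of_nonneg_left Real.pi_pos.le hℓ (by linarith)) 2) fun _ => le_rfl
  refine ⟨fun i => trigL2 _ (κ i) (c i) (b i), linearIndependent_contToL2 fun g hg => ?_,
    fun i => ⟨_, hκ i, (htrig i).isEigenvector⟩⟩
  have hzero : g 0 = 0 := by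
    simpa [κ, c, b, trig_apply, Fin.sum_univ_succ] using hg 0 0 ⟨le_rfl, hℓ.le⟩
  refine Fin.cases hzero fun i => ?_
  rw [← sum_mul_trig_edgeDifference hℓ Function.injective_id (fun i => g i.succ) i]
  simpa [κ, c, b, Fin.sum_univ_succ, hzero] using
    hg i.succ (ℓ / 2) ⟨by positivity, half_le_self hℓ.le⟩

lemma eq_pi_div_of_sum_cot_eq_zero [NeZero k] {κ : ℝ} (hℓ : 0 < ℓ) (hκ : 0 < κ)
    (hlt : κ * ℓ < Real.pi) (hcot : ∑ _i : Fin k, Real.cot (κ * ℓ) = 0) :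
    κ = Real.pi / (2 * ℓ) := by
  have hcot' : Real.cot (κ * ℓ) = Real.cot (Real.pi / 2) := by
    simpa [Real.cot_eq_cos_div_sin (Real.pi / 2), NeZero.ne k] using hcot
  have harg := strictAntiOn_cot.injOn ⟨by positivity, hlt⟩
    ⟨by positivity, half_lt_self Real.pi_pos⟩ hcot'
  rw [eq_div_iff (by positivity)]
  linarith

/-- The eigenfunctions with `κ < π / ℓ` satisfy `κ = π / (2 ℓ)` and are determined by their value at
the centre. -/
lemma starGraph_le_of_hasEigenvectorsLE_two [NeZero k] {t : ℝ}
    (h : (starGraph (Fin k) (fun _ => ℓ) (fun _ => hℓ) {none}ᶜ).HasEigenvectorsLE 2 t) :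
    (Real.pi / ℓ) ^ 2 ≤ t := by
  by_contra! ht
  obtain ⟨f, hf, heig⟩ := h
  have hlt : Real.pi / (2 * ℓ) * ℓ < Real.pi := by
    rw [show Real.pi / (2 * ℓ) * ℓ = Real.pi / 2 by field_simp]
    exact half_lt_self Real.pi_pos
  have htrig : ∀ i, ∃ c b, IsTrigSolution _ (Real.pi / (2 * ℓ)) c b ∧
      f i = trigL2 _ (Real.pi / (2 * ℓ)) c b := fun i => by
    obtain ⟨μ, hμ, hfμ⟩ := heig i
    obtain ⟨κ, hκ, rfl, c, b, h, hfi⟩ :=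
      starGraph_exists_isTrigSolution some_mem_compl_none (hf.ne_zero i) hfμ
    have hκℓ : κ * ℓ < Real.pi :=
      (lt_div_iff₀ hℓ).1 (lt_of_pow_lt_pow_left₀ 2 (by positivity) (hμ.trans_lt ht))
    obtain rfl := eq_pi_div_of_sum_cot_eq_zero hℓ hκ hκℓ (starGraph_sum_cot_eq_zero
      some_mem_compl_none (by simp) hκ (fun _ => hκℓ) h (hfi ▸ hf.ne_zero i))
    exact ⟨c, b, h, hfi⟩
  choose c b htrig hfi using htrig
  obtain ⟨s, t, hst, hne⟩ := exists_smul_add_smul_eq_zero (c 0 none) (c 1 none)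
  have hzero := starGraph_trigL2_eq_zero some_mem_compl_none (by positivity) (fun _ => hlt)
    ((htrig 0).linearCombination (htrig 1) s t) hst
  rw [trigL2_linearCombination, ← hfi, ← hfi] at hzero
  exact hne (eq_zero_and_eq_zero_of_linearIndependent hf zero_ne_one hzero)

lemma starGraph_eigenvalue_of_kirchhoff_centre [NeZero k] (hj : 2 ≤ j) (hjk : j ≤ k) :
    (starGraph (Fin k) (fun _ => ℓ) (fun _ => hℓ) {none}ᶜ).eigenvalue j = (Real.pi / ℓ) ^ 2 := by
  refine le_antisymm ?_ ?_
  · obtain ⟨n, rfl⟩ := Nat.exists_eq_succ_of_ne_zero (NeZero.ne k)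
    exact eigenvalue_le starGraph_isConnected (starGraph_dir_nonempty some_mem_compl_none)
      (by omega) ((starGraph_hasEigenvectorsLE_of_equal_length n).mono hjk)
  · exact le_eigenvalue starGraph_isConnected (starGraph_dir_nonempty some_mem_compl_none)
      fun _ hs => starGraph_le_of_hasEigenvectorsLE_two (hs.mono hj)

end EquilateralStar

end QuantumGraph

/-! ### Stars with many short edges -/

namespace QuantumGraph

/-- The edge lengths of `longShortStar n N`: `n` edges of length `1` and `N` of length `1 / 2`. -/
noncomputable def longShortLen (n N : ℕ) : Fin n ⊕ Fin N → ℝ := Sum.elim (fun _ => 1) fun _ => 1 / 2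

lemma longShortLen_pos {n N : ℕ} (i : Fin n ⊕ Fin N) : 0 < longShortLen n N i := by
  rcases i with i | i <;> simp [longShortLen]

/-- The star with `n` edges of length `1` and `N` edges of length `1 / 2`, with Dirichlet conditions
at its leaves and a Kirchhoff condition at its centre. As `N → ∞`, its first `n - 1` eigenvalues
tend to `π ^ 2`. -/
noncomputable abbrev longShortStar (n N : ℕ) [NeZero n] : QuantumGraph :=
  starGraph (Fin n ⊕ Fin N) (longShortLen n N) longShortLen_pos {none}ᶜ

lemma longShortStar_eigenvalue_le {k : ℕ} (hk : 1 ≤ k) (N : ℕ) :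
    (longShortStar (k + 1) N).eigenvalue k ≤ Real.pi ^ 2 := by
  simpa using starGraph_eigenvalue_le_of_equal_edges some_mem_compl_none one_pos
    Sum.inl_injective (fun _ => rfl) hk

lemma exists_sq_le_longShortStar_eigenvalue (n : ℕ) [NeZero n] {j : ℕ} {θ : ℝ} (hj : 1 ≤ j)
    (hθ : 0 < θ) (hθπ : θ < Real.pi) : ∃ N, θ ^ 2 ≤ (longShortStar n N).eigenvalue j := by
  have hcot : 0 < Real.cot (θ * (1 / 2)) := by
    rw [cot_eq_tan]
    exact Real.tan_pos_of_pos_of_lt_pi_div_two (by linarith) (by linarith)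
  obtain ⟨N, hN⟩ := exists_nat_ge (-(n * Real.cot θ) / Real.cot (θ * (1 / 2)))
  rw [div_le_iff₀ hcot] at hN
  refine ⟨N, starGraph_sq_le_eigenvalue some_mem_compl_none (by simp) hθ ?_ ?_ hj⟩
  · rintro (i | i) <;> simp only [longShortLen, Sum.elim_inl, Sum.elim_inr] <;> linarith
  · simp only [longShortLen, Fintype.sum_sum_type, Sum.elim_inl, Sum.elim_inr, mul_one,
      Finset.sum_const, Finset.card_univ, Fintype.card_fin, nsmul_eq_mul]
    linarith

lemma exists_isDirichletTree_ratio_le {k j : ℕ} {θ : ℝ} (hk : 1 ≤ k) (hj : 1 ≤ j) (hθ : 0 < θ)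
    (hθπ : θ < Real.pi) :
    ∃ Γ : QuantumGraph, Γ.IsDirichletTree ∧ Γ.ratio k j ≤ (Real.pi / θ) ^ 2 := by
  obtain ⟨N, hN⟩ := exists_sq_le_longShortStar_eigenvalue (k + 1) hj hθ hθπ
  refine ⟨longShortStar (k + 1) N, starGraph_isDirichletTree ?_, ?_⟩
  · simp only [Fintype.card_sum, Fintype.card_fin]
    omega
  · rw [ratio, div_pow]
    exact div_le_div₀ (by positivity) (longShortStar_eigenvalue_le hk N) (by positivity) hN

lemma le_one_of_forall_isDirichletTree_le_ratio {k j : ℕ} {y : ℝ} (hk : 1 ≤ k) (hj : 1 ≤ j)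
    (h : ∀ Γ : QuantumGraph, Γ.IsDirichletTree → y ≤ Γ.ratio k j) : y ≤ 1 := by
  have hlim : Filter.Tendsto (fun θ => (Real.pi / θ) ^ 2) (nhdsWithin Real.pi (Set.Iio Real.pi))
      (nhds ((Real.pi / Real.pi) ^ 2)) :=
    (tendsto_const_nhds.div (tendsto_nhdsWithin_of_tendsto_nhds Filter.tendsto_id)
      Real.pi_ne_zero).pow 2
  rw [div_self Real.pi_ne_zero, one_pow] at hlim
  refine ge_of_tendsto hlim ?_
  filter_upwards [Ioo_mem_nhdsLT Real.pi_pos] with θ hθ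
  obtain ⟨Γ, hΓ, hle⟩ := exists_isDirichletTree_ratio_le hk hj hθ.1 hθ.2
  exact (h Γ hΓ).trans hle

lemma isGLB_ratio_one {k j : ℕ} (hj : 1 ≤ j) (hjk : j ≤ k) {P : QuantumGraph → Prop}
    (hP : ∀ Γ : QuantumGraph, P Γ → Γ.IsWideDirichletTree)
    (hP' : ∀ Γ : QuantumGraph, Γ.IsDirichletTree → P Γ) :
    IsGLB {r : ℝ | ∃ Γ : QuantumGraph, P Γ ∧ Γ.ratio k j = r} 1 := by
  refine ⟨?_, fun y hy => le_one_of_forall_isDirichletTree_le_ratio (hj.trans hjk) hj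
    fun Γ h => hy ⟨Γ, hP' Γ h, rfl⟩⟩
  rintro _ ⟨Γ, hΓ, rfl⟩
  exact one_le_ratio (hP Γ hΓ).1.1 (hP Γ hΓ).dir_nonempty hj hjk

end QuantumGraph

/-! ### Equilateral stars -/

section EquilateralStars

open QuantumGraph

variable {k j : ℕ} [NeZero k] {ℓ : ℝ} {hℓ : 0 < ℓ}

lemma dirichletStar_isDirichletTree (hk : 2 ≤ k) : (dirichletStar k ℓ hℓ).IsDirichletTree :=
  starGraph_isDirichletTree (by rwa [Fintype.card_fin])

lemma dirichletStar_ratio (hj : 2 ≤ j) (hjk : j ≤ k) : (dirichletStar k ℓ hℓ).ratio k j = 1 := by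
  have hpos : 0 < (Real.pi / ℓ) ^ 2 := by positivity
  rw [QuantumGraph.ratio, starGraph_eigenvalue_of_kirchhoff_centre (hj.trans hjk) le_rfl,
    starGraph_eigenvalue_of_kirchhoff_centre hj hjk, div_self hpos.ne']

lemma dirichletStarWithDirichletCentre_isWideDirichletTree :
    (dirichletStarWithDirichletCentre k ℓ hℓ).IsWideDirichletTree :=
  ⟨starGraph_isTree, fun _ _ => Set.mem_univ _⟩

lemma dirichletStarWithDirichletCentre_hasInteriorDirichletVertex (hk : 2 ≤ k) :
    (dirichletStarWithDirichletCentre k ℓ hℓ).HasInteriorDirichletVertex :=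
  ⟨none, Set.mem_univ _, by rwa [starGraph_degree_none, Fintype.card_fin]⟩

lemma dirichletStarWithDirichletCentre_ratio (hj : 1 ≤ j) (hjk : j ≤ k) :
    (dirichletStarWithDirichletCentre k ℓ hℓ).ratio k j = 1 := by
  have hpos : 0 < (Real.pi / ℓ) ^ 2 := by positivity
  rw [QuantumGraph.ratio, starGraph_eigenvalue_of_dirichlet_centre (hj.trans hjk) le_rfl,
    starGraph_eigenvalue_of_dirichlet_centre hj hjk, div_self hpos.ne']

end EquilateralStars

theorem proposition1p9 (k j : ℕ) [NeZero k] (hj : 1 ≤ j) (hjk : j < k) :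
    -- the infimum is `1`, whether or not interior Dirichlet vertices are admitted
    IsGLB {r : ℝ | ∃ Γ : QuantumGraph, Γ.IsDirichletTree ∧ Γ.ratio k j = r} 1 ∧
    IsGLB {r : ℝ | ∃ Γ : QuantumGraph, Γ.IsWideDirichletTree ∧ Γ.ratio k j = r} 1 ∧
    -- it is attained if interior Dirichlet vertices are admitted
    (∃ Γ : QuantumGraph, Γ.IsWideDirichletTree ∧ Γ.ratio k j = 1) ∧
    -- for `j ≥ 2` it is attained on every equilateral `k`-star
    (2 ≤ j → ∀ (ℓ : ℝ) (hℓ : 0 < ℓ),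
      (dirichletStar k ℓ hℓ).IsDirichletTree ∧ (dirichletStar k ℓ hℓ).ratio k j = 1) ∧
    -- for `j = 1` it is attained only on graphs with an interior Dirichlet vertex
    (j = 1 → ∀ Γ : QuantumGraph, Γ.IsWideDirichletTree → Γ.ratio k j = 1 →
      Γ.HasInteriorDirichletVertex ∧ Γ.IsEffectivelyDisconnected) ∧
    -- it is attained on every equilateral `k`-star with a Dirichlet centre
    (∀ (ℓ : ℝ) (hℓ : 0 < ℓ),
      (dirichletStarWithDirichletCentre k ℓ hℓ).IsWideDirichletTree ∧
      (dirichletStarWithDirichletCentre k ℓ hℓ).HasInteriorDirichletVertex ∧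
      (dirichletStarWithDirichletCentre k ℓ hℓ).ratio k j = 1) := by
  have hcentre : ∀ (ℓ : ℝ) (hℓ : 0 < ℓ),
      (dirichletStarWithDirichletCentre k ℓ hℓ).IsWideDirichletTree ∧
      (dirichletStarWithDirichletCentre k ℓ hℓ).HasInteriorDirichletVertex ∧
      (dirichletStarWithDirichletCentre k ℓ hℓ).ratio k j = 1 := fun ℓ hℓ =>
    ⟨dirichletStarWithDirichletCentre_isWideDirichletTree,
      dirichletStarWithDirichletCentre_hasInteriorDirichletVertex (by omega),
      dirichletStarWithDirichletCentre_ratio hj hjk.le⟩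
  refine ⟨QuantumGraph.isGLB_ratio_one hj hjk.le (fun _ h => h.isWideDirichletTree) fun _ h => h,
    QuantumGraph.isGLB_ratio_one hj hjk.le (fun _ h => h) fun _ h => h.isWideDirichletTree,
    ⟨_, (hcentre 1 one_pos).1, (hcentre 1 one_pos).2.2⟩,
    fun hj2 ℓ hℓ => ⟨dirichletStar_isDirichletTree (by omega), dirichletStar_ratio hj2 hjk.le⟩,
    ?_, hcentre⟩
  rintro rfl Γ hΓ hratio
  have hdisc := QuantumGraph.isEffectivelyDisconnected_of_ratio_eq_one hΓ.1.1 hΓ.dir_nonempty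
    hjk hratio
  exact ⟨hdisc.hasInteriorDirichletVertex hΓ.1.1, hdisc⟩
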